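/- Let $X$ be a projective algebraic surface over $\mathbb C$ and let $C\subset X$ be a rational cuspidal curve, i.e. a reduced and irreducible curve, birational to $\mathbb P^1$, which is locally irreducible (has exactly one branch) at each of its singular points $z_1,\dots,z_n$. For each $j$ let $S_j\subset\mathbb Z_{\ge 0}$ be the semigroup of $z_j$, i.e. the set of all intersection multiplicities at $z_j$ of $C$ with curve germs not containing $C$; equivalently, $S_j=\{\operatorname{length}(\mathcal O_{C,z_j}/(f)) : 0\ne f\in\mathcal O_{C,z_j}\}$. For a semigroup $S\subset\mathbb Z_{\ge0}$ put $R_S(k)=\#(S\cap[0,k))$ for $k\in\mathbb Z$, for functions $R_1,R_2\colon\mathbb Z\to\mathbb Z$ bounded from below put $(R_1\diamond R_2)(k)=\min_{l\in\mathbb Z}\bigl(R_1(l)+R_2(k-l)\bigr)$, and let \[R=R_{S_1}\diamond R_{S_2}\diamond\dots\diamond R_{S_n}\] (if $C$ is smooth, so that $n=0$, let $R=R_{\mathbb Z_{\ge 0}}$, i.e. $R(k)=\max(k,0)$). Let $\mathcal L$ be a line bundle on $X$ such that $t:=\langle c_1(\mathcal L),C\rangle=\deg(\mathcal L|_C)>0$,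 such that $\Gamma(X,\mathcal L)\neq 0$, and such that no nonzero global section of $\mathcal L$ vanishes identically on $C$. Then $\Gamma(X,\mathcal L)$ is finite-dimensional and \[R(t+1)\ \ge\ \dim_{\mathbb C}\Gamma(X,\mathcal L).\] -/

import Mathlib

open CategoryTheory AlgebraicGeometry TopologicalSpace

noncomputable section

attribute [local instance] MvPolynomial.gradedAlgebra

/-! ### Projective varieties over `ℂ` -/

/-- The structure morphism of the projective space `ℙⁿ = Proj ℂ[x₀, …, xₙ]` over `ℂ`. -/
def projectiveSpaceHom (n : ℕ) :
    Proj (MvPolynomial.homogeneousSubmodule (Fin (n + 1)) ℂ) ⟶ Spec (.of ℂ) :=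
  Proj.toSpecZero (MvPolynomial.homogeneousSubmodule (Fin (n + 1)) ℂ) ≫
    Spec.map (CommRingCat.ofHom
      (algebraMap ℂ (MvPolynomial.homogeneousSubmodule (Fin (n + 1)) ℂ 0)))

/-- A (possibly singular) projective variety over `ℂ`: an integral `ℂ`-scheme that is isomorphic
over `ℂ` to a closed subscheme of some `ℙⁿ`. -/
structure ProjectiveVariety where
  /-- The underlying scheme. -/
  scheme : Scheme.{0}
  /-- The structure morphism. -/
  hom : scheme ⟶ Spec (.of ℂ)
  isIntegral : IsIntegral scheme
  isProjective : ∃ (n : ℕ)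
    (j : scheme ⟶ Proj (MvPolynomial.homogeneousSubmodule (Fin (n + 1)) ℂ)),
      IsClosedImmersion j ∧ j ≫ projectiveSpaceHom n = hom

instance (X : ProjectiveVariety) : IsIntegral X.scheme := X.isIntegral

instance (n : ℕ) : LocallyOfFiniteType (projectiveSpaceHom n) := by
  have ht : IsScalarTower ℂ (MvPolynomial.homogeneousSubmodule (Fin (n + 1)) ℂ 0)
      (MvPolynomial (Fin (n + 1)) ℂ) :=
    ⟨fun a b c => smul_mul_assoc a (b : MvPolynomial (Fin (n + 1)) ℂ) c⟩
  have h0 : Algebra.FiniteType (MvPolynomial.homogeneousSubmodule (Fin (n + 1)) ℂ 0)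
      (MvPolynomial (Fin (n + 1)) ℂ) :=
    Algebra.FiniteType.of_restrictScalars_finiteType ℂ _ _
  have h1 : LocallyOfFiniteType (Spec.map (CommRingCat.ofHom
      (algebraMap ℂ (MvPolynomial.homogeneousSubmodule (Fin (n + 1)) ℂ 0)))) := by
    rw [HasRingHomProperty.Spec_iff (P := @LocallyOfFiniteType)]
    refine RingHom.FiniteType.of_surjective _ ?_
    rintro ⟨p, hp⟩
    rw [MvPolynomial.mem_homogeneousSubmodule] at hp
    refine ⟨MvPolynomial.coeff 0 p, Subtype.ext ?_⟩
    exact ((MvPolynomial.totalDegree_eq_zero_iff_eq_C).mp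
      (Nat.le_zero.mp hp.totalDegree_le)).symm
  unfold projectiveSpaceHom
  infer_instance

/-- A projective variety over `ℂ` is locally Noetherian. -/
instance (X : ProjectiveVariety) : IsLocallyNoetherian X.scheme := by
  obtain ⟨n, j, hj, h⟩ := X.isProjective
  have : LocallyOfFiniteType X.hom := h ▸ inferInstance
  exact LocallyOfFiniteType.isLocallyNoetherian X.hom

/-! ### Line bundles and their sections -/

section LineBundles

variable {X : Scheme.{0}}

/-- Restriction of a section of `L` over `U` to a smaller open set `V`. -/
def resSection (L : X.Modules) {U V : X.Opens} (h : V ≤ U) (e : Γ(L, U)) : Γ(L, V) :=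
  L.presheaf.map (homOfLE h).op e

/-- `e` is a frame of `L` over `U`: multiplication by `e` is an isomorphism `𝒪_U ≅ L|_U`. -/
def IsFrame (L : X.Modules) (U : X.Opens) (e : Γ(L, U)) : Prop :=
  ∀ (V : X.Opens) (h : V ≤ U),
    Function.Bijective (fun a : Γ(X, V) => (a • resSection L h e : Γ(L, V)))

/-- `L` is a line bundle (invertible sheaf): it is locally isomorphic to `𝒪_X`. -/
def IsLineBundle (L : X.Modules) : Prop :=
  ∀ x : X, ∃ (U : X.Opens) (_ : x ∈ U) (e : Γ(L, U)), IsFrame L U e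

/-- The global section `u` of the line bundle `L` vanishes at the point `x`: writing `u = a • e`
in terms of a local frame `e` around `x`, the function `a` lies in the maximal ideal of
`𝒪_{X,x}` (`X.basicOpen a` is the set of points where `a` is a unit). -/
def VanishesAt (L : X.Modules) (u : Γ(L, ⊤)) (x : X) : Prop :=
  ∀ (U : X.Opens) (_ : x ∈ U) (e : Γ(L, U)), IsFrame L U e →
    ∀ a : Γ(X, U), resSection L le_top u = a • e → x ∉ X.basicOpen a

end LineBundles

/-- The space of global sections `Γ(X, L)`. -/
def GlobalSections (X : ProjectiveVariety) (L : X.scheme.Modules) : Type :=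
  Γ(L, (⊤ : X.scheme.Opens))

instance (X : ProjectiveVariety) (L : X.scheme.Modules) : AddCommGroup (GlobalSections X L) :=
  inferInstanceAs (AddCommGroup Γ(L, (⊤ : X.scheme.Opens)))

/-- `Γ(X, L)` as a complex vector space, through `ℂ → Γ(X, 𝒪_X)`. -/
instance (X : ProjectiveVariety) (L : X.scheme.Modules) : Module ℂ (GlobalSections X L) :=
  letI : Module Γ(X.scheme, ⊤) (GlobalSections X L) :=
    inferInstanceAs (Module Γ(X.scheme, ⊤) Γ(L, (⊤ : X.scheme.Opens)))
  Module.compHom (GlobalSections X L)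
    ((Scheme.ΓSpecIso (.of ℂ)).inv ≫ X.hom.appTop).hom

/-! ### The degree of a line bundle on a curve -/

section Degree

variable {C X : Scheme.{0}}

lemma genericPoint_mem_preimage [IsIntegral C] (i : C ⟶ X) {U : X.Opens} {z : C}
    (hz : i z ∈ U) : genericPoint C ∈ i ⁻¹ᵁ U :=
  (genericPoint_specializes z).mem_open (i ⁻¹ᵁ U).isOpen hz

/-- A nonzero rational section of the pullback of a line bundle `L` along `i : C ⟶ X`.
It is given by its coefficient in the function field of `C` with respect to every local frame of
`L` whose domain meets `C`; if `e = a • f` for two frames, then the coefficient with respect to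
`f` is the pullback of `a` times the coefficient with respect to `e`. -/
structure RationalSection [IsIntegral C] (i : C ⟶ X) (L : X.Modules) where
  /-- The coefficient of the section with respect to a frame. -/
  coeff (U : X.Opens) (e : Γ(L, U)) (he : IsFrame L U e) (hU : genericPoint C ∈ i ⁻¹ᵁ U) :
    C.functionField
  coeff_ne_zero (U : X.Opens) (e : Γ(L, U)) (he : IsFrame L U e)
    (hU : genericPoint C ∈ i ⁻¹ᵁ U) : coeff U e he hU ≠ 0
  coeff_change (U V : X.Opens) (e : Γ(L, U)) (f : Γ(L, V)) (he : IsFrame L U e)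
    (hf : IsFrame L V f) (hU : genericPoint C ∈ i ⁻¹ᵁ U) (hV : genericPoint C ∈ i ⁻¹ᵁ V)
    (a : Γ(X, U ⊓ V))
    (ha : resSection L (inf_le_left : U ⊓ V ≤ U) e =
      a • resSection L (inf_le_right : U ⊓ V ≤ V) f) :
    coeff V f hf hV =
      C.presheaf.germ (i ⁻¹ᵁ (U ⊓ V)) (genericPoint C) ⟨hU, hV⟩ (i.app (U ⊓ V) a) *
        coeff U e he hU

/-- `D` is the divisor of the rational section `s` on the curve `C`: its coefficient at `z` is the
order of vanishing at `z` of the coefficient of `s` with respect to any frame around `z`. -/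
def IsDivisorOf [IsIntegral C] [IsLocallyNoetherian C] {i : C ⟶ X} {L : X.Modules}
    (s : RationalSection i L) (D : C →₀ ℤ) : Prop :=
  ∀ (z : C) (U : X.Opens) (hz : i z ∈ U) (e : Γ(L, U)) (he : IsFrame L U e),
    D z = C.ord (s.coeff U e he (genericPoint_mem_preimage i hz)) z

/-- `t = ⟨c₁(L), C⟩` for a complete curve `i : C ⟶ X` over an algebraically closed field: `t` is
the degree of the divisor of a nonzero rational section of `L|_C`. (All closed points of `C` have
degree one. The order of vanishing at the generic point is `0`.) -/
def IsDegree [IsIntegral C] [IsLocallyNoetherian C] (i : C ⟶ X) (L : X.Modules) (t : ℤ) : Prop :=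
  ∃ (s : RationalSection i L) (D : C →₀ ℤ), IsDivisorOf s D ∧ t = D.sum fun _ m => m

end Degree

/-! ### Cusps, semigroups and the function `R` -/

section Cusps

variable (C : Scheme.{0}) [IsIntegral C]

/-- `z` is a singular point of `C`. -/
def IsSingularPoint (z : C) : Prop := ¬ IsRegularLocalRing (C.presheaf.stalk z)

/-- `C` is locally irreducible (has exactly one branch) at `z`: the integral closure of `𝒪_{C,z}`
in the function field has exactly one maximal ideal, that is, exactly one point of the
normalization lies over `z`. -/
def IsLocallyIrreducibleAt (z : C) : Prop :=
  IsLocalRing (integralClosure (C.presheaf.stalk z) C.functionField)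

/-- All singular points of `C` are cusps. -/
def IsCuspidal : Prop := ∀ z : C, IsSingularPoint C z → IsLocallyIrreducibleAt C z

variable {C} in
/-- The semigroup of the curve `C` at `z`: the set of intersection multiplicities
`length (𝒪_{C,z} / f)` at `z` of `C` with the curve germs `f = 0` that do not contain `C`. -/
def pointSemigroup (z : C) : AddSubmonoid ℕ where
  carrier := {m | ∃ f : C.presheaf.stalk z, f ≠ 0 ∧ Ring.ord (C.presheaf.stalk z) f = (m : ℕ∞)}
  zero_mem' := ⟨1, one_ne_zero, by simp⟩
  add_mem' := by
    rintro m n ⟨f, hf, hm⟩ ⟨g, hg, hn⟩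
    refine ⟨f * g, mul_ne_zero hf hg, ?_⟩
    rw [Ring.ord_mul _ (mem_nonZeroDivisors_of_ne_zero hg), hm, hn]
    push_cast
    rfl

end Cusps

/-- `R_S(t) = #(S ∩ [0, t))`. -/
def semigroupCount (S : AddSubmonoid ℕ) (t : ℤ) : ℤ :=
  (Set.ncard {m : ℕ | m ∈ S ∧ (m : ℤ) < t} : ℤ)

/-- The infimum convolution `(R₁ ⋄ R₂)(t) = min_k (R₁(k) + R₂(t - k))` of functions that are
bounded from below. -/
def infConvolution (R₁ R₂ : ℤ → ℤ) (t : ℤ) : ℤ := ⨅ k : ℤ, (R₁ k + R₂ (t - k))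

/-- `R_{S₁} ⋄ … ⋄ R_{Sₙ}`. For `n = 0` this is the counting function `t ↦ max(t, 0)` of the
semigroup `ℕ` of a smooth point, which is neutral for `⋄` on counting functions of semigroups. -/
def countingFunction : List (AddSubmonoid ℕ) → ℤ → ℤ
  | [] => semigroupCount ⊤
  | [S] => semigroupCount S
  | S :: T :: l => infConvolution (semigroupCount S) (countingFunction (T :: l))

end

/-!
A rational curve `C` has function field `ℂ(T)`, and where `C` is unibranch the local ring has a
single place of `ℂ(T)` above it, so the closed points of a rational cuspidal curve correspond to the
points of `ℙ¹`. As the residue fields are all `ℂ`, the length of `𝒪_{C,z} / f` is the valuation of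
`f` at the place above `z`. Hence principal divisors on `C` have degree `0`, because those on `ℙ¹`
do, and two germs at `z` of the same order become, after subtracting a scalar multiple, a germ of
higher order.

The orders of germs at `z` lie in the semigroup `S` of `z`, so vanishing to order at least `m` at
`z` costs at most `R_S(m)` linear conditions on the sections of `L`. If `R(t + 1) < dim Γ(X, L)`,
then for some `m₁ + ⋯ + mₙ = t + 1` vanishing to order at least `mⱼ` at every `zⱼ` is fewer
conditions in total than there are sections, so some nonzero section vanishes to total order more
than `t` along `C`. This is impossible: its pullback to `C` has an effective divisor of degree `t`.
-/

noncomputable section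

/-! ### Places of the rational function field -/

section RationalFunctionField

open Polynomial IntermediateField

variable {k K : Type*} [Field k] [Field K] [Algebra k K] {A : Subring K}

lemma nonneg_of_zpow_mul_mem {π u : K} (hπ : π ∈ A) (hπ' : π⁻¹ ∉ A) (hu : u⁻¹ ∈ A) (hu0 : u ≠ 0)
    {n : ℤ} (h : π ^ n * u ∈ A) : 0 ≤ n := by
  by_contra! hn
  obtain ⟨m, rfl⟩ : ∃ m : ℕ, n = -(m + 1 : ℤ) := ⟨(-n - 1).toNat, by omega⟩
  have hπ0 : π ≠ 0 := by rintro rfl; simp [A.zero_mem] at hπ'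
  have : π⁻¹ = π ^ m * (π ^ (-(m + 1 : ℤ)) * u) * u⁻¹ := by
    rw [zpow_neg, zpow_add₀ hπ0, zpow_natCast]
    field_simp
  exact hπ' (this ▸ mul_mem (mul_mem (pow_mem hπ m) h) hu)

lemma aeval_mem_subring (hk : ∀ c : k, algebraMap k K c ∈ A) {S : K} (hS : S ∈ A) (p : k[X]) :
    aeval S p ∈ A := by
  rw [aeval_eq_sum_range]
  refine sum_mem fun i _ => ?_
  rw [Algebra.smul_def]
  exact mul_mem (hk _) (pow_mem hS _)

lemma exists_aeval_eq_eval_add_mul (S : K) (a : k) (p : k[X]) :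
    ∃ q : k[X], aeval S p = algebraMap k K (p.eval a) + (S - algebraMap k K a) * aeval S q := by
  obtain ⟨q, hq⟩ := X_sub_C_dvd_sub_C_eval (a := a) (p := p)
  refine ⟨q, ?_⟩
  have := congrArg (aeval S) hq
  simp only [map_sub, map_mul, aeval_C, aeval_X] at this
  rw [← this]; ring

lemma inv_aeval_mem_subring [IsLocalRing A] (hk : ∀ c : k, algebraMap k K c ∈ A) {S : K}
    (hS : S ∈ A) {a : k} (ha : (S - algebraMap k K a)⁻¹ ∉ A) {p : k[X]} (hp : p.eval a ≠ 0) :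
    aeval S p ≠ 0 ∧ (aeval S p)⁻¹ ∈ A := by
  obtain ⟨q, hq⟩ := exists_aeval_eq_eval_add_mul S a p
  let π : A := ⟨S - algebraMap k K a, sub_mem hS (hk a)⟩
  let x : A := ⟨aeval S p, aeval_mem_subring hk hS p⟩
  let y : A := ⟨aeval S q, aeval_mem_subring hk hS q⟩
  let c : A := ⟨algebraMap k K (p.eval a), hk _⟩
  have inv_mem {z : A} (hz : IsUnit z) : (z : K) ≠ 0 ∧ (z : K)⁻¹ ∈ A := by
    obtain ⟨w, hw⟩ := hz.exists_right_inv
    have hw' : (z : K) * w = 1 := congrArg Subtype.val hw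
    exact ⟨left_ne_zero_of_mul_eq_one hw', eq_inv_of_mul_eq_one_right hw' ▸ w.2⟩
  have hπ : π ∈ IsLocalRing.maximalIdeal A := fun h => ha (inv_mem h).2
  have hc : IsUnit c := .of_mul_eq_one ⟨algebraMap k K (p.eval a)⁻¹, hk _⟩
    (Subtype.ext (by simp [c, hp]))
  refine inv_mem (z := x) (by_contra fun hx => ?_)
  have hcx : c = x - π * y := Subtype.ext (by simp [c, x, π, y, hq])
  exact (IsLocalRing.mem_maximalIdeal c).mp
    (hcx ▸ sub_mem ((IsLocalRing.mem_maximalIdeal x).mpr hx) (Ideal.mul_mem_right _ _ hπ)) hc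

lemma exists_eq_zpow_mul_aeval_div {S : K} (hS : k⟮S⟯ = ⊤) {a : k}
    (ha0 : S - algebraMap k K a ≠ 0) {x : K} (hx : x ≠ 0) :
    ∃ (n : ℤ) (p q : k[X]), p.eval a ≠ 0 ∧ q.eval a ≠ 0 ∧
      x = (S - algebraMap k K a) ^ n * (aeval S p / aeval S q) := by
  obtain ⟨p, q, rfl⟩ := (mem_adjoin_simple_iff k x).mp (by rw [hS]; trivial)
  have hp0 : p ≠ 0 := by rintro rfl; simp at hx
  have hq0 : q ≠ 0 := by rintro rfl; simp at hx
  obtain ⟨p', hp', hpd⟩ := exists_eq_pow_rootMultiplicity_mul_and_not_dvd p hp0 a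
  obtain ⟨q', hq', hqd⟩ := exists_eq_pow_rootMultiplicity_mul_and_not_dvd q hq0 a
  refine ⟨(p.rootMultiplicity a : ℤ) - q.rootMultiplicity a, p', q',
    by rwa [dvd_iff_isRoot] at hpd, by rwa [dvd_iff_isRoot] at hqd, ?_⟩
  conv_lhs => rw [hp', hq']
  rw [zpow_sub₀ ha0, zpow_natCast, zpow_natCast]
  simp only [map_mul, map_pow, map_sub, aeval_X, aeval_C]
  ring

lemma exists_eq_aeval_div_of_mem_subring [IsLocalRing A] (hk : ∀ c : k, algebraMap k K c ∈ A)
    {S : K} (hS : k⟮S⟯ = ⊤) (hSA : S ∈ A) {a : k} (ha0 : S - algebraMap k K a ≠ 0)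
    (ha : (S - algebraMap k K a)⁻¹ ∉ A) {x : K} (hx : x ∈ A) :
    ∃ p q : k[X], q.eval a ≠ 0 ∧ x = aeval S p / aeval S q := by
  by_cases hx0 : x = 0
  · exact ⟨0, 1, by simp, by simp [hx0]⟩
  obtain ⟨n, p, q, hp, hq, rfl⟩ := exists_eq_zpow_mul_aeval_div hS ha0 hx0
  have hu : (aeval S p / aeval S q)⁻¹ ∈ A := by
    rw [inv_div, div_eq_mul_inv]
    exact mul_mem (aeval_mem_subring hk hSA q) (inv_aeval_mem_subring hk hSA ha hp).2
  lift n to ℕ using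
    nonneg_of_zpow_mul_mem (sub_mem hSA (hk a)) ha hu (right_ne_zero_of_mul hx0) hx
  refine ⟨(X - C a) ^ n * p, q, hq, ?_⟩
  simp only [zpow_natCast, map_mul, map_pow, map_sub, aeval_X, aeval_C, mul_div_assoc]

variable (k A) in
/-- The subring `A` of `K` is a discrete valuation ring of `K` with uniformizer `π` and residue
field `k`. It is applied to the normalization of the local ring of a curve at a point with one
branch. -/
structure IsUniformizer (π : K) : Prop where
  mem : π ∈ A
  inv_notMem : π⁻¹ ∉ A
  exists_eq_zpow_mul (x : K) (hx : x ≠ 0) : ∃ (n : ℤ) (u : K), u ∈ A ∧ u⁻¹ ∈ A ∧ x = π ^ n * u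
  exists_sub_mem (x : K) (hx : x ∈ A) : ∃ c : k, ∃ y ∈ A, x = algebraMap k K c + π * y

lemma isUniformizer_sub_algebraMap [IsLocalRing A] (hk : ∀ c : k, algebraMap k K c ∈ A)
    {S : K} (hS : k⟮S⟯ = ⊤) (hSA : S ∈ A) {a : k} (ha0 : S - algebraMap k K a ≠ 0)
    (ha : (S - algebraMap k K a)⁻¹ ∉ A) :
    IsUniformizer k A (S - algebraMap k K a) := by
  have div_mem {p q : k[X]} (hq : q.eval a ≠ 0) : aeval S p / aeval S q ∈ A := by
    rw [div_eq_mul_inv]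
    exact mul_mem (aeval_mem_subring hk hSA p) (inv_aeval_mem_subring hk hSA ha hq).2
  refine ⟨sub_mem hSA (hk a), ha, fun x hx => ?_, fun x hx => ?_⟩
  · obtain ⟨n, p, q, hp, hq, rfl⟩ := exists_eq_zpow_mul_aeval_div hS ha0 hx
    exact ⟨n, _, div_mem hq, inv_div (aeval S p) _ ▸ div_mem hp, rfl⟩
  · obtain ⟨p, q, hq, rfl⟩ := exists_eq_aeval_div_of_mem_subring hk hS hSA ha0 ha hx
    have hq0 : aeval S q ≠ 0 := (inv_aeval_mem_subring hk hSA ha hq).1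
    obtain ⟨r, hr⟩ := exists_aeval_eq_eval_add_mul S a (p - C (p.eval a / q.eval a) * q)
    refine ⟨p.eval a / q.eval a, aeval S r / aeval S q, div_mem hq, ?_⟩
    simp only [map_sub, map_mul, aeval_C, eval_sub, eval_mul, eval_C,
      div_mul_cancel₀ _ hq, sub_self, map_zero, zero_add] at hr
    rw [← mul_div_assoc, ← hr]
    field_simp
    ring

namespace IsUniformizer

variable {π : K}

lemma ne_zero (h : IsUniformizer k A π) : π ≠ 0 := by
  rintro rfl
  exact h.inv_notMem (by simp)

lemma mem_or_inv_mem (h : IsUniformizer k A π) (x : K) : x ∈ A ∨ x⁻¹ ∈ A := by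
  by_cases hx : x = 0
  · exact .inl (hx ▸ A.zero_mem)
  obtain ⟨n, u, hu, hu', rfl⟩ := h.exists_eq_zpow_mul x hx
  obtain ⟨m, rfl | rfl⟩ := n.eq_nat_or_neg
  · exact .inl (mul_mem (by simpa using pow_mem h.mem m) hu)
  · exact .inr (by simpa using mul_mem hu' (pow_mem h.mem m))

/-- The valuation ring with uniformizer `π`. -/
def valuationSubring (h : IsUniformizer k A π) : ValuationSubring K := .ofSubring A h.mem_or_inv_mem

lemma mem_valuationSubring (h : IsUniformizer k A π) {x : K} : x ∈ h.valuationSubring ↔ x ∈ A :=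
  .rfl

end IsUniformizer

end RationalFunctionField

/-! ### Normalization of a unibranch local ring -/

section Normalization

open Polynomial IntermediateField

variable {R K : Type*} [CommRing R] [Field K] [Algebra R K]

lemma isIntegral_inv_of_aeval_eq_zero {y : K} {P : R[X]} (hP : aeval y P = 0)
    (h0 : IsUnit (P.coeff 0)) : IsIntegral R y⁻¹ := by
  nontriviality R
  by_cases hy : y = 0
  · simpa [hy] using isIntegral_zero (R := R) (B := K)
  let := invertibleOfNonzero hy
  have hroot : aeval y⁻¹ P.reverse = 0 := (eval₂_reverse_eq_zero_iff _ y P).mpr hP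
  have hint := isIntegral_leadingCoeff_smul _ _ hroot
  rw [reverse_leadingCoeff, trailingCoeff_eq_coeff_zero h0.ne_zero] at hint
  simpa [smul_smul] using hint.smul ((h0.unit⁻¹ : Rˣ) : R)

lemma inv_mem_of_isIntegral_inv {B : Subalgebra R K} {y : K} (hy : y ∈ B)
    (h : IsIntegral R y⁻¹) : y⁻¹ ∈ B := by
  by_cases hy0 : y = 0
  · simp [hy0]
  let : Invertible y⁻¹ := ⟨y, mul_inv_cancel₀ hy0, inv_mul_cancel₀ hy0⟩
  obtain ⟨p, hp, hroot⟩ := h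
  have hrev : aeval y p.reverse = 0 := (eval₂_reverse_eq_zero_iff _ y⁻¹ p).mpr hroot
  rw [← X_mul_divX_add p.reverse, coeff_zero_reverse, hp.leadingCoeff, map_add, map_mul, aeval_X,
    map_one, map_one, add_eq_zero_iff_neg_eq, ← mul_neg] at hrev
  rw [← eq_inv_of_mul_eq_one_right hrev]
  exact neg_mem (Algebra.adjoin_le (Set.singleton_subset_iff.mpr hy)
    (aeval_mem_adjoin_singleton R y))

variable {k : Type*} [Field k] [Algebra k K] [Algebra k R] [IsScalarTower k R K]

lemma algebraMap_mem_of_isScalarTower (B : Subalgebra R K) (c : k) : algebraMap k K c ∈ B := by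
  rw [IsScalarTower.algebraMap_apply k R K]
  exact B.algebraMap_mem _

lemma exists_isIntegral_inv_sub [Infinite k] [IsLocalRing R] [IsFractionRing R K]
    (hR : ¬ IsField R) {T : K} (hT : k⟮T⟯ = ⊤) :
    ∃ c : k, IsIntegral R (T - algebraMap k K c)⁻¹ := by
  obtain ⟨f, hf, hf0⟩ : ∃ f ∈ IsLocalRing.maximalIdeal R, f ≠ 0 :=
    Submodule.exists_mem_ne_zero_of_ne_bot fun h =>
      hR (IsLocalRing.isField_iff_maximalIdeal_eq.mpr h)
  have hf0' : algebraMap R K f ≠ 0 := (IsFractionRing.injective R K).ne_iff' (map_zero _) |>.mpr hf0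
  obtain ⟨p, q, hpq⟩ := (mem_adjoin_simple_iff k (algebraMap R K f)).mp (by rw [hT]; trivial)
  have hp : p ≠ 0 := by rintro rfl; simp [hf0'] at hpq
  have hq : aeval T q ≠ 0 := by intro h; simp [h, hf0'] at hpq
  obtain ⟨c, hc⟩ : ∃ c, p.eval c ≠ 0 := by
    by_contra! h
    exact hp (Polynomial.funext fun x => by simpa using h x)
  let P : R[X] := (p.map (algebraMap k R) - C f * q.map (algebraMap k R)).comp
    (X + C (algebraMap k R c))
  refine ⟨c, isIntegral_inv_of_aeval_eq_zero (P := P) ?_ ?_⟩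
  · simp [P, aeval_comp, ← IsScalarTower.algebraMap_apply, aeval_map_algebraMap, hpq,
      div_mul_cancel₀ _ hq]
  · have hP0 : P.coeff 0 = algebraMap k R (p.eval c) - f * algebraMap k R (q.eval c) := by
      simp [P, coeff_zero_eq_eval_zero, eval_map_algebraMap, aeval_algebraMap_apply]
    have hunit : IsUnit (algebraMap k R (p.eval c)) := (IsUnit.mk0 _ hc).map _
    by_contra h
    have hmem := add_mem ((IsLocalRing.mem_maximalIdeal _).mpr h)
      (Ideal.mul_mem_right (algebraMap k R (q.eval c)) (IsLocalRing.maximalIdeal R) hf)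
    rw [hP0, sub_add_cancel] at hmem
    exact (IsLocalRing.mem_maximalIdeal _).mp hmem hunit

lemma exists_inv_sub_notMem_integralClosure [IsAlgClosed k] [IsFractionRing R K]
    (hR : ¬ IsField R) {S : K} (hS : k⟮S⟯ = ⊤) (hSint : IsIntegral R S) :
    ∃ a : k, S - algebraMap k K a ≠ 0 ∧ ¬ IsIntegral R (S - algebraMap k K a)⁻¹ := by
  by_contra! h
  have hk (c : k) : algebraMap k K c ∈ integralClosure R K := algebraMap_mem_of_isScalarTower _ c
  have inv_aeval (q : k[X]) : (aeval S q)⁻¹ ∈ integralClosure R K := by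
    rw [(IsAlgClosed.splits q).eq_prod_roots]
    simp only [map_mul, mul_inv, aeval_C, ← map_inv₀]
    refine mul_mem (hk _) ?_
    rw [map_multiset_prod, ← Multiset.prod_map_inv', Multiset.map_map, Multiset.map_map]
    refine multiset_prod_mem _ fun x hx => ?_
    obtain ⟨b, -, rfl⟩ := Multiset.mem_map.mp hx
    simp only [Function.comp_apply, map_sub, aeval_X, aeval_C]
    by_cases hb : S - algebraMap k K b = 0
    · simp [hb]
    · exact h b hb
  have : Algebra.IsIntegral R K := ⟨fun x => by
    obtain ⟨p, q, rfl⟩ := (mem_adjoin_simple_iff k x).mp (by rw [hS]; trivial)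
    rw [div_eq_mul_inv]
    exact mul_mem (aeval_mem_subring (A := (integralClosure R K).toSubring) hk hSint p)
      (inv_aeval q)⟩
  exact hR (isField_of_isIntegral_of_isField (IsFractionRing.injective R K)
    (Semifield.toIsField K))

lemma fg_integralClosure [IsLocalRing (integralClosure R K)] {S : K} (hS : k⟮S⟯ = ⊤)
    (hSint : IsIntegral R S) {a : k} (ha0 : S - algebraMap k K a ≠ 0)
    (ha : ¬ IsIntegral R (S - algebraMap k K a)⁻¹) :
    (Subalgebra.toSubmodule (integralClosure R K)).FG := by
  suffices h : integralClosure R K = Algebra.adjoin R {S} from h ▸ hSint.fg_adjoin_singleton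
  have hk (B : Subalgebra R K) (c : k) : algebraMap k K c ∈ B.toSubring :=
    algebraMap_mem_of_isScalarTower _ c
  have hSadj : S ∈ Algebra.adjoin R {S} := Algebra.self_mem_adjoin_singleton R S
  refine le_antisymm (fun x hx => ?_) (Algebra.adjoin_le (Set.singleton_subset_iff.mpr hSint))
  obtain ⟨p, q, hq, rfl⟩ := exists_eq_aeval_div_of_mem_subring
    (A := (integralClosure R K).toSubring) (hk _) hS hSint ha0 ha hx
  rw [div_eq_mul_inv]
  exact mul_mem (aeval_mem_subring (hk (Algebra.adjoin R {S})) hSadj p)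
    (inv_mem_of_isIntegral_inv (aeval_mem_subring (hk (Algebra.adjoin R {S})) hSadj q)
      (inv_aeval_mem_subring (A := (integralClosure R K).toSubring) (hk _) hSint ha hq).2)

end Normalization

/-! ### Orders of vanishing and relative lengths -/

section RelativeLength

open Pointwise

variable {R M : Type*} [CommRing R] [AddCommGroup M] [Module R M]

/-- The length of `A / B` for submodules `B ≤ A`. -/
def relLength (A B : Submodule R M) : ℕ∞ := Module.length R (A ⧸ B.submoduleOf A)

lemma relLength_add {A B C : Submodule R M} (hBA : B ≤ A) (hCB : C ≤ B) :
    relLength A C = relLength B C + relLength A B := by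
  have h₁ : C.submoduleOf B ≤ (C.submoduleOf A).comap (Submodule.inclusion hBA) := fun _ hx => hx
  have h₂ : C.submoduleOf A ≤ B.submoduleOf A := fun _ hx => hCB hx
  refine Module.length_eq_add_of_exact
    (Submodule.mapQ (C.submoduleOf B) (C.submoduleOf A) (Submodule.inclusion hBA) h₁)
    (Submodule.factor h₂) ?_ (Submodule.factor_surjective h₂) fun y => ?_
  · rw [← LinearMap.ker_eq_bot, eq_bot_iff]
    intro x hx
    obtain ⟨x, rfl⟩ := Submodule.Quotient.mk_surjective _ x
    rw [LinearMap.mem_ker, Submodule.mapQ_apply, Submodule.Quotient.mk_eq_zero] at hx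
    exact (Submodule.Quotient.mk_eq_zero _).mpr hx
  · obtain ⟨y, rfl⟩ := Submodule.Quotient.mk_surjective _ y
    refine (Submodule.Quotient.mk_eq_zero (B.submoduleOf A)).trans ⟨fun h => ?_, ?_⟩
    · exact ⟨Submodule.Quotient.mk ⟨y, h⟩, rfl⟩
    · rintro ⟨x, hx⟩
      obtain ⟨x, rfl⟩ := Submodule.Quotient.mk_surjective _ x
      have hsub : (x : M) - y ∈ C := (Submodule.Quotient.eq (C.submoduleOf A)).mp hx
      have hy := sub_mem x.2 (hCB hsub)
      rwa [sub_sub_self] at hy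

lemma relLength_smul {G : Type*} [GroupWithZero G] [DistribMulAction G M] [SMulCommClass G R M]
    {g : G} (hg : g ≠ 0) (A B : Submodule R M) : relLength (g • A) (g • B) = relLength A B := by
  let e : M ≃ₗ[R] M := DistribMulAction.toLinearEquiv R M (Units.mk0 g hg)
  refine (LinearEquiv.length_eq
    (Submodule.Quotient.equiv (B.submoduleOf A) _ (e.submoduleMap A) ?_)).symm
  ext ⟨_, y, hy, rfl⟩
  rw [Submodule.mem_map_equiv]
  change e.symm (e y) ∈ B ↔ g • y ∈ g • B
  rw [e.symm_apply_apply, Submodule.mem_smul_pointwise_iff_exists]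
  simp only [(MulAction.injective₀ hg).eq_iff, exists_eq_right]

lemma relLength_smul_eq_of_le {G : Type*} [GroupWithZero G] [DistribMulAction G M]
    [SMulCommClass G R M] {g : G} (hg : g ≠ 0) {A B : Submodule R M} (hAB : A ≤ B)
    (hA : g • A ≤ A) (hB : g • B ≤ B) (h : relLength B A ≠ ⊤) :
    relLength A (g • A) = relLength B (g • B) := by
  have := relLength_add hAB hA
  rw [relLength_add hB (smul_mono_right g hAB), relLength_smul hg, add_comm] at this
  exact (ENat.add_left_injective_of_ne_top h this).symm

lemma isFiniteLength_of_smul_eq_zero [IsDomain R] [IsNoetherianRing R] [Ring.KrullDimLE 1 R]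
    [Module.Finite R M] {d : R} (hd : d ≠ 0) (h : ∀ x : M, d • x = 0) : IsFiniteLength R M := by
  have hR := isFiniteLength_quotient_span_singleton R (mem_nonZeroDivisors_of_ne_zero hd)
  rw [isFiniteLength_iff_isNoetherian_isArtinian] at hR ⊢
  have htors : Module.IsTorsionBySet R M (Ideal.span {d}) :=
    (Module.isTorsionBySet_span_singleton_iff d).mpr fun {x} => h x
  let := htors.module
  have : IsScalarTower R (R ⧸ Ideal.span {d}) M := htors.isScalarTower
  have := Module.Finite.of_restrictScalars_finite R (R ⧸ Ideal.span {d}) M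
  have := hR.2
  have : IsArtinianRing (R ⧸ Ideal.span {d}) := isArtinian_of_tower R inferInstance
  exact ⟨inferInstance, isArtinian_of_surjective_algebraMap
    (Ideal.Quotient.mk_surjective (I := Ideal.span {d}))⟩

lemma relLength_ne_top [IsDomain R] [IsNoetherianRing R] [Ring.KrullDimLE 1 R]
    {A B : Submodule R M} (hA : A.FG) {d : R} (hd : d ≠ 0) (h : ∀ x ∈ A, d • x ∈ B) :
    relLength A B ≠ ⊤ := by
  have := Module.Finite.iff_fg.mpr hA
  refine Module.length_ne_top_iff.mpr (isFiniteLength_of_smul_eq_zero hd fun x => ?_)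
  obtain ⟨x, rfl⟩ := Submodule.Quotient.mk_surjective _ x
  exact (Submodule.Quotient.mk_eq_zero _).mpr (h x x.2)

end RelativeLength

section OrdFrac

open Pointwise

variable {R K k : Type*} [CommRing R] [Field K] [Algebra R K] [Field k] [Algebra k K]

lemma smul_toSubmodule_le {A : Subalgebra R K} {x : K} (hx : x ∈ A) :
    x • A.toSubmodule ≤ A.toSubmodule := by
  rintro _ ⟨y, hy, rfl⟩
  exact A.mul_mem hx hy

lemma relLength_mul_smul {A : Subalgebra R K} {x y : K} (hx0 : x ≠ 0) (hx : x ∈ A) (hy : y ∈ A) :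
    relLength A.toSubmodule ((x * y) • A.toSubmodule) =
      relLength A.toSubmodule (y • A.toSubmodule) +
        relLength A.toSubmodule (x • A.toSubmodule) := by
  rw [mul_smul, relLength_add (smul_toSubmodule_le hx) (smul_mono_right x (smul_toSubmodule_le hy)),
    relLength_smul hx0]

lemma IsUniformizer.relLength_smul_eq_one [Algebra k R] [IsScalarTower k R K]
    {A : Subalgebra R K} {π : K} (hπ : IsUniformizer k A.toSubring π) :
    relLength A.toSubmodule (π • A.toSubmodule) = 1 := by
  rw [relLength, Module.length_eq_one_iff, isSimpleModule_iff_toSpanSingleton_surjective]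
  constructor
  · rw [Submodule.Quotient.nontrivial_iff, Ne, Submodule.submoduleOf_eq_top]
    intro h
    have := (Submodule.mem_smul_iff_inv_mul_mem hπ.ne_zero).mp (h A.one_mem)
    exact hπ.inv_notMem (by rwa [mul_one] at this)
  · intro x hx y
    obtain ⟨⟨x, hxA⟩, rfl⟩ := Submodule.Quotient.mk_surjective _ x
    obtain ⟨⟨y, hyA⟩, rfl⟩ := Submodule.Quotient.mk_surjective _ y
    obtain ⟨c, x', hx', rfl⟩ := hπ.exists_sub_mem x hxA
    obtain ⟨d, y', hy', rfl⟩ := hπ.exists_sub_mem y hyA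
    have hc : c ≠ 0 := by
      rintro rfl
      exact hx ((Submodule.Quotient.mk_eq_zero _).mpr ⟨x', hx', by simp⟩)
    refine ⟨algebraMap k R (d / c), ?_⟩
    rw [LinearMap.toSpanSingleton_apply, ← Submodule.Quotient.mk_smul, Submodule.Quotient.eq]
    refine ⟨algebraMap R K (algebraMap k R (d / c)) * x' - y',
      A.sub_mem (A.mul_mem (A.algebraMap_mem _) hx') hy', ?_⟩
    have : algebraMap k K c ≠ 0 := by simpa using hc
    change π * (algebraMap R K (algebraMap k R (d / c)) * x' - y') =
      algebraMap k R (d / c) • (algebraMap k K c + π * x') - (algebraMap k K d + π * y')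
    rw [Algebra.smul_def, ← IsScalarTower.algebraMap_apply, map_div₀]
    field_simp
    ring

variable [IsFractionRing R K]

lemma relLength_one_smul_one (r : R) :
    relLength (1 : Submodule R K) (algebraMap R K r • (1 : Submodule R K)) = Ring.ord R r := by
  let f : R ≃ₗ[R] (1 : Submodule R K) :=
    (LinearEquiv.ofInjective (Algebra.linearMap R K) (IsFractionRing.injective R K)).trans
      (LinearEquiv.ofEq _ _ Submodule.one_eq_range.symm)
  have hf (s : R) : (f s : K) = algebraMap R K s := rfl
  refine (LinearEquiv.length_eq (Submodule.Quotient.equiv (Ideal.span {r}) _ f ?_)).symm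
  ext y
  obtain ⟨s, rfl⟩ := f.surjective y
  rw [Submodule.mem_map_equiv, f.symm_apply_apply, Ideal.mem_span_singleton,
    Submodule.submoduleOf, Submodule.mem_comap, Submodule.smul_one_eq_span]
  simp [Submodule.mem_span_singleton, hf, Algebra.smul_def, ← map_mul,
    dvd_iff_exists_eq_mul_left, eq_comm]

variable [IsDomain R] [IsNoetherianRing R] [Ring.KrullDimLE 1 R]

lemma relLength_algebraMap_smul {A : Subalgebra R K} (hA : A.toSubmodule.FG) {r : R} (hr : r ≠ 0) :
    relLength A.toSubmodule (algebraMap R K r • A.toSubmodule) = Ring.ord R r := by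
  obtain ⟨d, hd, h⟩ := FractionalIdeal.isFractional_of_fg (S := nonZeroDivisors R) hA
  have hr' : algebraMap R K r ≠ 0 := by simpa using hr
  have h1 : (1 : Submodule R K) ≤ A.toSubmodule := by
    rw [Submodule.one_le]; exact A.one_mem
  have h11 : algebraMap R K r • (1 : Submodule R K) ≤ 1 := by
    rw [Submodule.smul_one_eq_span, Submodule.span_singleton_le_iff_mem]
    exact Submodule.algebraMap_mem r
  rw [← relLength_one_smul_one (K := K) r,
    relLength_smul_eq_of_le hr' h1 h11 (smul_toSubmodule_le (A.algebraMap_mem r))]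
  exact relLength_ne_top hA (nonZeroDivisors.ne_zero hd) fun x hx => Submodule.mem_one.mpr (h x hx)

lemma ordFrac_eq_exp {A : Subalgebra R K} (hA : A.toSubmodule.FG) {x : K} (hx : x ≠ 0)
    (hxA : x ∈ A) {n : ℕ} (hn : relLength A.toSubmodule (x • A.toSubmodule) = n) :
    Ring.ordFrac R x = WithZero.exp (n : ℤ) := by
  obtain ⟨r, s, hs, rfl⟩ := IsFractionRing.div_surjective (A := R) x
  have hs0 : s ≠ 0 := nonZeroDivisors.ne_zero hs
  have hr0 : r ≠ 0 := by rintro rfl; simp at hx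
  have hs' : algebraMap R K s ≠ 0 := by simpa using hs0
  obtain ⟨m, hm⟩ := ENat.ne_top_iff_exists.mp (Ring.ord_ne_top hs)
  have hadd : Ring.ord R r = n + Ring.ord R s := by
    rw [← relLength_algebraMap_smul hA hr0, ← relLength_algebraMap_smul hA hs0, ← hn,
      ← relLength_mul_smul hs' (A.algebraMap_mem s) hxA, mul_div_cancel₀ _ hs']
  rw [map_div₀, Ring.ordFrac_eq_ord R hr0, Ring.ordFrac_eq_ord R hs0,
    Ring.ordMonoidWithZeroHom_eq_coe R hs hm.symm,
    Ring.ordMonoidWithZeroHom_eq_coe R (mem_nonZeroDivisors_of_ne_zero hr0) (n := n + m)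
      (by rw [hadd, ← hm, Nat.cast_add])]
  change WithZero.exp ((n + m : ℕ) : ℤ) / WithZero.exp (m : ℤ) = _
  rw [← WithZero.exp_sub, Nat.cast_add, add_sub_cancel_right]

lemma ordFrac_eq_one {A : Subalgebra R K} (hA : A.toSubmodule.FG) {u : K} (hu : u ≠ 0)
    (huA : u ∈ A) (huA' : u⁻¹ ∈ A) : Ring.ordFrac R u = 1 := by
  refine (ordFrac_eq_exp hA hu huA (n := 0) ?_).trans (by simp)
  rw [Nat.cast_zero, relLength, Module.length_eq_zero_iff,
    Submodule.Quotient.subsingleton_iff, Submodule.submoduleOf_eq_top]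
  exact fun y hy => (Submodule.mem_smul_iff_inv_mul_mem hu).mpr (A.mul_mem huA' hy)

namespace IsUniformizer

variable [Algebra k R] [IsScalarTower k R K] {A : Subalgebra R K} {π : K}
  (hπ : IsUniformizer k A.toSubring π)
include hπ

lemma ordFrac_self (hA : A.toSubmodule.FG) :
    Ring.ordFrac R π = WithZero.exp 1 :=
  ordFrac_eq_exp hA hπ.ne_zero hπ.mem (hπ.relLength_smul_eq_one.trans Nat.cast_one.symm)

lemma mem_iff_one_le_ordFrac (hA : A.toSubmodule.FG) {x : K} (hx : x ≠ 0) :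
    x ∈ A ↔ 1 ≤ Ring.ordFrac R x := by
  obtain ⟨n, u, hu, hu', rfl⟩ := hπ.exists_eq_zpow_mul x hx
  have hu0 : u ≠ 0 := right_ne_zero_of_mul hx
  rw [map_mul, ordFrac_eq_one hA hu0 hu hu', mul_one, map_zpow₀, hπ.ordFrac_self hA,
    ← WithZero.exp_zsmul, smul_eq_mul, mul_one, ← WithZero.exp_zero, WithZero.exp_le_exp]
  refine ⟨nonneg_of_zpow_mul_mem hπ.mem hπ.inv_notMem hu' hu0, fun hn => ?_⟩
  lift n to ℕ using hn
  exact A.mul_mem (by simpa using pow_mem hπ.mem n) hu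

lemma min_ordFrac_le_add (hA : A.toSubmodule.FG) {x y : K} (h : x + y ≠ 0) :
    min (Ring.ordFrac R x) (Ring.ordFrac R y) ≤ Ring.ordFrac R (x + y) := by
  wlog hxy : Ring.ordFrac R x ≤ Ring.ordFrac R y generalizing x y
  · rw [min_comm, add_comm x y]
    exact this (by rwa [add_comm]) (le_of_not_ge hxy)
  rw [min_eq_left hxy]
  by_cases hx : x = 0
  · simp [hx]
  have hx' : 0 < Ring.ordFrac R x := zero_lt_iff.mpr (by simpa using hx)
  have hdiv : y / x ∈ A := by
    by_cases hy : y = 0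
    · simp [hy]
    rw [hπ.mem_iff_one_le_ordFrac hA (div_ne_zero hy hx), map_div₀]
    exact (one_le_div₀ hx').mpr hxy
  have h1 : 1 + y / x ∈ A := add_mem (one_mem _) hdiv
  have hsplit : x + y = x * (1 + y / x) := by field_simp
  rw [hsplit] at h ⊢
  rw [hπ.mem_iff_one_le_ordFrac hA (right_ne_zero_of_mul h)] at h1
  rw [map_mul]
  exact le_mul_of_one_le_right' h1

lemma exists_sub_eq_zero_or_lt (hA : A.toSubmodule.FG) {x y : K} (hy : y ≠ 0)
    (hxy : Ring.ordFrac R x = Ring.ordFrac R y) :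
    ∃ c : k, x - algebraMap k K c * y = 0 ∨
      Ring.ordFrac R y < Ring.ordFrac R (x - algebraMap k K c * y) := by
  have hy' : Ring.ordFrac R y ≠ 0 := by simpa using hy
  have hx : x ≠ 0 := by
    rintro rfl
    exact hy' (hxy.symm.trans (map_zero _))
  have hdiv : x / y ∈ A := by
    rw [hπ.mem_iff_one_le_ordFrac hA (div_ne_zero hx hy), map_div₀, hxy, div_self hy']
  obtain ⟨c, z, hz, hzc⟩ := hπ.exists_sub_mem _ hdiv
  refine ⟨c, ?_⟩
  have hsplit : x - algebraMap k K c * y = π * z * y := by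
    rw [div_eq_iff hy] at hzc
    rw [hzc]; ring
  rw [hsplit]
  by_cases hz0 : z = 0
  · left; simp [hz0]
  right
  have hz1 : 1 ≤ Ring.ordFrac R z := (hπ.mem_iff_one_le_ordFrac hA hz0).mp hz
  rw [map_mul, map_mul, hπ.ordFrac_self hA]
  calc Ring.ordFrac R y = 1 * Ring.ordFrac R y := (one_mul _).symm
    _ < WithZero.exp 1 * Ring.ordFrac R y :=
      mul_lt_mul_of_pos_right (by rw [← WithZero.exp_zero, WithZero.exp_lt_exp]; exact zero_lt_one)
        (zero_lt_iff.mpr hy')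
    _ ≤ WithZero.exp 1 * Ring.ordFrac R z * Ring.ordFrac R y := by
      gcongr
      exact le_mul_of_one_le_right' hz1

end IsUniformizer

end OrdFrac

/-! ### Places and points of the projective line -/

section Place

open Polynomial IntermediateField WithZero
open scoped OnePoint

variable {α : Type*}

open Classical in
/-- The order at the point `P` of the projective line of the rational function `T - b`. -/
def linearOrd (P : OnePoint α) (b : α) : ℤ :=
  if P = b then 1 else if P = ∞ then -1 else 0

lemma linearOrd_infty (b : α) : linearOrd ∞ b = -1 := by simp [linearOrd]

lemma linearOrd_coe [DecidableEq α] (a b : α) :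
    linearOrd (a : OnePoint α) b = if a = b then 1 else 0 := by
  simp [linearOrd]

lemma linearOrd_pos_iff {P : OnePoint α} {b : α} : 0 < linearOrd P b ↔ P = b := by
  unfold linearOrd
  split_ifs <;> simp_all

lemma linearOrd_neg_iff {P : OnePoint α} {b : α} : linearOrd P b < 0 ↔ P = ∞ := by
  unfold linearOrd
  split_ifs <;> simp_all

variable {k K : Type*} [Field k] [Field K] [Algebra k K]

lemma ne_zero_induction_of_adjoin_eq_top [IsAlgClosed k] {T : K} (hT : k⟮T⟯ = ⊤) {Q : K → Prop}
    (hconst : ∀ c : k, c ≠ 0 → Q (algebraMap k K c))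
    (hlin : ∀ b : k, T - algebraMap k K b ≠ 0 → Q (T - algebraMap k K b))
    (hmul : ∀ x y : K, x ≠ 0 → y ≠ 0 → Q x → Q y → Q (x * y))
    (hinv : ∀ x : K, x ≠ 0 → Q x → Q x⁻¹) (x : K) (hx : x ≠ 0) : Q x := by
  have hprod (s : Multiset k) : (s.map fun b => T - algebraMap k K b).prod ≠ 0 →
      Q (s.map fun b => T - algebraMap k K b).prod := by
    induction s using Multiset.induction with
    | empty => intro _; simpa using hconst 1 one_ne_zero
    | cons b s ih =>
      intro h
      rw [Multiset.map_cons, Multiset.prod_cons] at h ⊢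
      exact hmul _ _ (left_ne_zero_of_mul h) (right_ne_zero_of_mul h)
        (hlin b (left_ne_zero_of_mul h)) (ih (right_ne_zero_of_mul h))
  have hpol (p : k[X]) (hp : aeval T p ≠ 0) : Q (aeval T p) := by
    rw [(IsAlgClosed.splits p).eq_prod_roots, map_mul, aeval_C, map_multiset_prod,
      Multiset.map_map] at hp ⊢
    simp only [Function.comp_def, map_sub, aeval_X, aeval_C] at hp ⊢
    have hc := left_ne_zero_of_mul hp
    exact hmul _ _ hc (right_ne_zero_of_mul hp)
      (hconst _ ((map_ne_zero_iff _ (algebraMap k K).injective).mp hc))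
      (hprod _ (right_ne_zero_of_mul hp))
  obtain ⟨p, q, rfl⟩ := (mem_adjoin_simple_iff k x).mp (by rw [hT]; trivial)
  rw [div_ne_zero_iff] at hx
  rw [div_eq_mul_inv]
  exact hmul _ _ hx.1 (inv_ne_zero hx.2) (hpol _ hx.1) (hinv _ hx.2 (hpol _ hx.2))

/-- `v` is the order of vanishing at the point `P` of the projective line with coordinate `T`,
in multiplicative notation. -/
structure IsPlace (v : K →*₀ ℤᵐ⁰) (T : K) (P : OnePoint k) : Prop where
  map_algebraMap (c : k) (hc : c ≠ 0) : v (algebraMap k K c) = 1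
  map_sub_algebraMap (b : k) : v (T - algebraMap k K b) = exp (linearOrd P b)

namespace IsPlace

variable {v w : K →*₀ ℤᵐ⁰} {T : K} {P Q : OnePoint k}

lemma sub_algebraMap_ne_zero (h : IsPlace v T P) (b : k) : T - algebraMap k K b ≠ 0 := by
  intro h0
  have := h.map_sub_algebraMap b
  rw [h0, map_zero] at this
  exact exp_ne_zero this.symm

lemma transcendental [IsAlgClosed k] (h : IsPlace v T P) : Transcendental k T := by
  intro hT
  obtain ⟨b, hb⟩ := minpoly.mem_range_of_degree_eq_one k T
    (IsAlgClosed.degree_eq_one_of_irreducible k (minpoly.irreducible hT.isIntegral))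
  exact h.sub_algebraMap_ne_zero b (by rw [hb, sub_self])

lemma unique (hP : IsPlace v T P) (hQ : IsPlace v T Q) : P = Q := by
  have h (b : k) : linearOrd P b = linearOrd Q b :=
    exp_injective ((hP.map_sub_algebraMap b).symm.trans (hQ.map_sub_algebraMap b))
  induction P using OnePoint.rec with
  | coe a => exact (linearOrd_pos_iff.mp (h a ▸ linearOrd_pos_iff.mpr rfl)).symm
  | infty => exact (linearOrd_neg_iff.mp (h 0 ▸ linearOrd_neg_iff.mpr rfl)).symm

lemma eq [IsAlgClosed k] (hT : k⟮T⟯ = ⊤) (hv : IsPlace v T P) (hw : IsPlace w T P) : v = w := by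
  ext x
  by_cases hx : x = 0
  · rw [hx, map_zero, map_zero]
  refine ne_zero_induction_of_adjoin_eq_top hT (Q := fun x => v x = w x) (fun c hc => ?_)
    (fun b _ => ?_) (fun x y _ _ hx hy => ?_) (fun x _ hx => ?_) x hx
  · rw [hv.map_algebraMap c hc, hw.map_algebraMap c hc]
  · rw [hv.map_sub_algebraMap, hw.map_sub_algebraMap]
  · rw [map_mul, map_mul, hx, hy]
  · rw [map_inv₀, map_inv₀, hx]

lemma algebraMap_add (h : IsPlace v T P) (c : k) :
    IsPlace v (algebraMap k K c + T) (OnePoint.map (c + ·) P) where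
  map_algebraMap := h.map_algebraMap
  map_sub_algebraMap b := by
    classical
    rw [add_comm, add_sub_assoc, ← neg_sub, ← sub_eq_add_neg, ← map_sub, h.map_sub_algebraMap]
    induction P using OnePoint.rec with
    | coe a =>
      have hab : a = b - c ↔ c + a = b := by rw [eq_sub_iff_add_eq, add_comm]
      rw [OnePoint.map_some, linearOrd_coe, linearOrd_coe]
      exact congrArg exp (if_congr hab rfl rfl)
    | infty => rw [OnePoint.map_infty, linearOrd_infty, linearOrd_infty]

lemma exists_inv_of_coe {a : k} (h : IsPlace v T (a : OnePoint k)) :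
    ∃ P : OnePoint k, IsPlace v T⁻¹ P := by
  classical
  have hT : v T = exp (linearOrd (a : OnePoint k) 0) := by simpa using h.map_sub_algebraMap 0
  have hT0 : T ≠ 0 := by simpa using h.sub_algebraMap_ne_zero 0
  have hzero : v (T⁻¹ - algebraMap k K 0) = exp (-linearOrd (a : OnePoint k) 0) := by
    rw [map_zero, sub_zero, map_inv₀, hT, exp_neg]
  have hsub (b : k) (hb : b ≠ 0) : v (T⁻¹ - algebraMap k K b) =
      exp (linearOrd (a : OnePoint k) b⁻¹ - linearOrd (a : OnePoint k) 0) := by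
    have hb' : algebraMap k K b ≠ 0 := by simpa using hb
    have : T⁻¹ - algebraMap k K b = algebraMap k K (-b) * ((T - algebraMap k K b⁻¹) / T) := by
      rw [map_neg, map_inv₀]; field_simp; ring
    rw [this, map_mul, h.map_algebraMap _ (neg_ne_zero.mpr hb), one_mul, map_div₀,
      h.map_sub_algebraMap, hT, exp_sub]
  by_cases ha : a = 0
  · refine ⟨∞, h.map_algebraMap, fun b => ?_⟩
    by_cases hb : b = 0
    · rw [hb, hzero, ha]; simp [linearOrd]
    · rw [hsub b hb, ha]; simp [linearOrd, Ne.symm hb]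
  · refine ⟨(a⁻¹ : k), h.map_algebraMap, fun b => ?_⟩
    by_cases hb : b = 0
    · rw [hb, hzero]; simp [linearOrd, ha]
    · rw [hsub b hb, linearOrd_coe a 0, if_neg ha, sub_zero, linearOrd_coe, linearOrd_coe]
      exact congrArg exp (if_congr inv_eq_iff_eq_inv.symm rfl rfl)

end IsPlace

lemma exists_valuationSubring_mem_nonunits {U : K} (hU : Transcendental k U) :
    ∃ W : ValuationSubring K, (∀ c : k, algebraMap k K c ∈ W) ∧ U ∈ W.nonunits := by
  let A : Subring K := (Algebra.adjoin k {U}).toSubring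
  have hUA : U ∈ A := Algebra.self_mem_adjoin_singleton k U
  have hI : Ideal.span {(⟨U, hUA⟩ : A)} ≠ ⊤ := by
    rw [Ne, Ideal.span_singleton_eq_top]
    intro hu
    obtain ⟨⟨y, hy⟩, hUy⟩ := hu.exists_right_inv
    have hUy : U * y = 1 := congrArg Subtype.val hUy
    obtain ⟨p, rfl⟩ : ∃ p : k[X], aeval U p = y := by
      have hy : y ∈ Algebra.adjoin k {U} := hy
      rwa [Algebra.adjoin_singleton_eq_range_aeval] at hy
    have h := (transcendental_iff.mp hU) (X * p - 1) (by simp [hUy])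
    simpa using congrArg (eval 0) h
  obtain ⟨W, hAW, hW⟩ := Ideal.image_subset_nonunits_valuationSubring _ hI
  exact ⟨W, fun c => hAW ((Algebra.adjoin k {U}).algebraMap_mem c),
    hW ⟨_, Ideal.subset_span rfl, rfl⟩⟩

section Unibranch

variable {R : Type*} [CommRing R] [IsDomain R] [IsNoetherianRing R] [Ring.KrullDimLE 1 R]
  [Algebra R K] [IsFractionRing R K] [Algebra k R] [IsScalarTower k R K]

lemma ordFrac_algebraMap_eq_one (c : k) (hc : c ≠ 0) :
    Ring.ordFrac R (algebraMap k K c) = 1 := by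
  rw [IsScalarTower.algebraMap_apply k R K]
  exact Ring.ordFrac_of_isUnit ((IsUnit.mk0 c hc).map (algebraMap k R))

variable [IsLocalRing (integralClosure R K)]

lemma isPlace_coe_of_isIntegral {S : K} (hSint : IsIntegral R S) {a : k}
    (ha : ¬ IsIntegral R (S - algebraMap k K a)⁻¹)
    (hπ : IsUniformizer k (integralClosure R K).toSubring (S - algebraMap k K a))
    (hfg : (Subalgebra.toSubmodule (integralClosure R K)).FG) :
    IsPlace (Ring.ordFrac R : K →*₀ ℤᵐ⁰) S (a : OnePoint k) where
  map_algebraMap := ordFrac_algebraMap_eq_one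
  map_sub_algebraMap b := by
    classical
    rw [linearOrd_coe]
    split_ifs with hab
    · rw [← hab, hπ.ordFrac_self hfg]
    have h := inv_aeval_mem_subring (A := (integralClosure R K).toSubring)
      (algebraMap_mem_of_isScalarTower _) hSint ha (p := X - C b) (by simpa [sub_eq_zero] using hab)
    simp only [map_sub, aeval_X, aeval_C] at h
    exact ordFrac_eq_one hfg h.1
      (sub_mem (S := Subalgebra R K) hSint (algebraMap_mem_of_isScalarTower _ b)) h.2

theorem exists_isUniformizer_isPlace [IsAlgClosed k] [IsLocalRing R] (hR : ¬ IsField R) {T : K}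
    (hT : k⟮T⟯ = ⊤) :
    ∃ π : K, IsUniformizer k (integralClosure R K).toSubring π ∧
      (Subalgebra.toSubmodule (integralClosure R K)).FG ∧
      ∃ P : OnePoint k, IsPlace (Ring.ordFrac R) T P := by
  have := IsAlgClosed.instInfinite (K := k)
  obtain ⟨c, hc⟩ := exists_isIntegral_inv_sub (k := k) hR hT
  set S := (T - algebraMap k K c)⁻¹ with hS
  have hTS : T = algebraMap k K c + S⁻¹ := by rw [hS, inv_inv, add_sub_cancel]
  have hS' : k⟮S⟯ = ⊤ := by
    rw [eq_top_iff, ← hT, adjoin_simple_le_iff, hTS]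
    exact add_mem (IntermediateField.algebraMap_mem _ _) (inv_mem (mem_adjoin_simple_self k S))
  obtain ⟨a, ha0, ha⟩ := exists_inv_sub_notMem_integralClosure (k := k) hR hS' hc
  have hπ := isUniformizer_sub_algebraMap (A := (integralClosure R K).toSubring)
    (algebraMap_mem_of_isScalarTower _) hS' hc ha0 ha
  have hfg := fg_integralClosure hS' hc ha0 ha
  obtain ⟨P, hP⟩ := (isPlace_coe_of_isIntegral hc ha hπ hfg).exists_inv_of_coe
  exact ⟨_, hπ, hfg, _, hTS ▸ hP.algebraMap_add c⟩

end Unibranch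

end Place

/-! ### Valuation rings of the function field -/

lemma algebraMap_homogeneousSubmodule_zero_surjective {σ k : Type*} [CommSemiring k] :
    Function.Surjective (algebraMap k (MvPolynomial.homogeneousSubmodule σ k 0)) := by
  rintro ⟨p, hp⟩
  rw [MvPolynomial.mem_homogeneousSubmodule] at hp
  exact ⟨p.coeff 0, Subtype.ext
    (MvPolynomial.totalDegree_eq_zero_iff_eq_C.mp (Nat.le_zero.mp hp.totalDegree_le)).symm⟩

instance (n : ℕ) : IsProper (projectiveSpaceHom n) := by
  have : IsScalarTower ℂ (MvPolynomial.homogeneousSubmodule (Fin (n + 1)) ℂ 0)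
      (MvPolynomial (Fin (n + 1)) ℂ) :=
    ⟨fun a b c => smul_mul_assoc a (b : MvPolynomial (Fin (n + 1)) ℂ) c⟩
  have : Algebra.FiniteType (MvPolynomial.homogeneousSubmodule (Fin (n + 1)) ℂ 0)
      (MvPolynomial (Fin (n + 1)) ℂ) :=
    Algebra.FiniteType.of_restrictScalars_finiteType ℂ _ _
  have : IsClosedImmersion (Spec.map (CommRingCat.ofHom
      (algebraMap ℂ (MvPolynomial.homogeneousSubmodule (Fin (n + 1)) ℂ 0)))) :=
    IsClosedImmersion.spec_of_surjective _ algebraMap_homogeneousSubmodule_zero_surjective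
  unfold projectiveSpaceHom
  infer_instance

namespace ProjectiveVariety

variable (X : ProjectiveVariety)

instance : IsProper X.hom := by
  obtain ⟨n, j, hj, h⟩ := X.isProjective
  rw [← h]
  infer_instance

lemma valuativeCriterion_hom : ValuativeCriterion X.hom := by
  have h : IsProper X.hom := inferInstance
  rw [IsProper.eq_valuativeCriterion] at h
  exact h.1.1.1

/-- The ring homomorphism that makes the local rings of `X` algebras over `ℂ`. -/
def constants : ℂ →+* Γ(X.scheme, ⊤) :=
  ((Scheme.ΓSpecIso (.of ℂ)).inv ≫ X.hom.appTop).hom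

lemma hom_eq_toSpecΓ_comp : X.hom =
    X.scheme.toSpecΓ ≫ Spec.map (CommRingCat.ofHom X.constants) := by
  have h : X.hom ≫ Spec.map (Scheme.ΓSpecIso (.of ℂ)).hom = X.scheme.toSpecΓ ≫
      Spec.map X.hom.appTop := by
    rw [SpecMap_ΓSpecIso_hom]
    exact Scheme.toSpecΓ_naturality X.hom
  calc X.hom
    _ = (X.hom ≫ Spec.map (Scheme.ΓSpecIso (.of ℂ)).hom) ≫
        Spec.map (Scheme.ΓSpecIso (.of ℂ)).inv := by
      rw [Category.assoc, ← Spec.map_comp, Iso.inv_hom_id, Spec.map_id, Category.comp_id]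
    _ = X.scheme.toSpecΓ ≫ Spec.map (CommRingCat.ofHom X.constants) := by
      rw [h, Category.assoc, ← Spec.map_comp]
      rfl

variable {X}

instance (z : X.scheme) : Algebra ℂ (X.scheme.presheaf.stalk z) :=
  ((X.scheme.presheaf.germ ⊤ z trivial).hom.comp X.constants).toAlgebra

lemma algebraMap_stalk_apply (z : X.scheme) (c : ℂ) :
    algebraMap ℂ (X.scheme.presheaf.stalk z) c =
      X.scheme.presheaf.germ ⊤ z trivial (X.constants c) := rfl

instance (z : X.scheme) :
    IsScalarTower ℂ (X.scheme.presheaf.stalk z) X.scheme.functionField :=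
  .of_algebraMap_eq fun c =>
    (X.scheme.presheaf.germ_stalkSpecializes_apply
      (U := ⊤) trivial ((genericPoint_spec X.scheme).specializes trivial) (X.constants c)).symm

lemma fromSpecStalk_comp_hom (z : X.scheme) : X.scheme.fromSpecStalk z ≫ X.hom =
    Spec.map (CommRingCat.ofHom (algebraMap ℂ (X.scheme.presheaf.stalk z))) := by
  rw [hom_eq_toSpecΓ_comp, Scheme.fromSpecStalk_toSpecΓ_assoc, ← Spec.map_comp]
  rfl

/-- The valuation ring `W` of the function field dominates the local ring of `X` at `z`, that is,
`z` is the center of `W` on `X`. -/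
def Dominates (W : ValuationSubring X.scheme.functionField) (z : X.scheme) : Prop :=
  ∃ ψ : X.scheme.presheaf.stalk z →+* W, IsLocalHom ψ ∧
    ∀ r, (ψ r : X.scheme.functionField) = algebraMap _ _ r

/-- The square of the valuative criterion for the valuation ring `W` of the function field. -/
def valuativeCommSq (W : ValuationSubring X.scheme.functionField)
    (hW : ∀ c : ℂ, algebraMap ℂ X.scheme.functionField c ∈ W) : ValuativeCommSq X.hom where
  R := W
  K := X.scheme.functionField
  i₁ := X.scheme.fromSpecStalk (genericPoint X.scheme)
  i₂ := Spec.map (CommRingCat.ofHom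
    ((algebraMap ℂ X.scheme.functionField).codRestrict W.toSubring hW))
  commSq := ⟨by
    rw [fromSpecStalk_comp_hom, ← Spec.map_comp]
    rfl⟩

lemma exists_dominates (W : ValuationSubring X.scheme.functionField)
    (hW : ∀ c : ℂ, algebraMap ℂ X.scheme.functionField c ∈ W) :
    ∃ z : X.scheme, Dominates W z := by
  obtain ⟨⟨l, hl, -⟩⟩ := X.valuativeCriterion_hom.existence (valuativeCommSq W hW)
  change Spec (.of W) ⟶ X.scheme at l
  refine ⟨l (IsLocalRing.closedPoint (CommRingCat.of W)), (Scheme.stalkClosedPointTo l).hom,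
    inferInstance, fun r => ?_⟩
  have h : Spec.map (CommRingCat.ofHom (algebraMap W X.scheme.functionField)) ≫
      Spec.map (Scheme.stalkClosedPointTo l) ≫ X.scheme.fromSpecStalk _ =
      X.scheme.fromSpecStalk (genericPoint X.scheme) := by
    rw [Scheme.Spec_stalkClosedPointTo_fromSpecStalk]
    exact hl
  rw [← Scheme.SpecMap_stalkSpecializes_fromSpecStalk ((genericPoint_spec X.scheme).specializes
      (y := l (IsLocalRing.closedPoint (CommRingCat.of W))) trivial), ← Category.assoc,
    cancel_mono, ← Spec.map_comp] at h
  exact congrArg (fun f => f.hom r) (Spec.map_injective h)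

lemma Dominates.exists_liftStruct {W : ValuationSubring X.scheme.functionField} {z : X.scheme}
    (hz : Dominates W z) (hW : ∀ c : ℂ, algebraMap ℂ X.scheme.functionField c ∈ W) :
    ∃ l : (valuativeCommSq W hW).commSq.LiftStruct,
      (show Spec (.of W) ⟶ X.scheme from l.l) (IsLocalRing.closedPoint (CommRingCat.of W)) = z := by
  obtain ⟨ψ, hψ, hψK⟩ := hz
  let ψ' : X.scheme.presheaf.stalk z ⟶ CommRingCat.of W := CommRingCat.ofHom ψ
  refine ⟨⟨Spec.map ψ' ≫ X.scheme.fromSpecStalk z, ?_, ?_⟩, ?_⟩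
  · change Spec.map (CommRingCat.ofHom (algebraMap W X.scheme.functionField)) ≫
      Spec.map ψ' ≫ X.scheme.fromSpecStalk z = X.scheme.fromSpecStalk (genericPoint X.scheme)
    rw [← Scheme.SpecMap_stalkSpecializes_fromSpecStalk
      ((genericPoint_spec X.scheme).specializes (y := z) trivial), ← Category.assoc,
      ← Spec.map_comp]
    congr 2
    ext r
    exact hψK r
  · change (Spec.map ψ' ≫ X.scheme.fromSpecStalk z) ≫ X.hom = Spec.map (CommRingCat.ofHom
      ((algebraMap ℂ X.scheme.functionField).codRestrict W.toSubring hW))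
    rw [Category.assoc, fromSpecStalk_comp_hom, ← Spec.map_comp]
    congr 1
    ext c
    exact (hψK _).trans
      (IsScalarTower.algebraMap_apply ℂ (X.scheme.presheaf.stalk z) _ c).symm
  · have hclosed : Spec.map ψ' (IsLocalRing.closedPoint (CommRingCat.of W)) =
        IsLocalRing.closedPoint (X.scheme.presheaf.stalk z) :=
      IsLocalRing.comap_closedPoint ψ
    exact (congrArg (X.scheme.fromSpecStalk z) hclosed).trans Scheme.fromSpecStalk_closedPoint

lemma Dominates.eq {W : ValuationSubring X.scheme.functionField} {z z' : X.scheme}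
    (hz : Dominates W z) (hz' : Dominates W z')
    (hW : ∀ c : ℂ, algebraMap ℂ X.scheme.functionField c ∈ W) : z = z' := by
  have hu := X.valuativeCriterion_hom.uniqueness (valuativeCommSq W hW)
  obtain ⟨l, rfl⟩ := hz.exists_liftStruct hW
  obtain ⟨l', rfl⟩ := hz'.exists_liftStruct hW
  rw [Subsingleton.elim l l']

lemma Dominates.algebraMap_mem {W : ValuationSubring X.scheme.functionField} {z : X.scheme}
    (hz : Dominates W z) (r : X.scheme.presheaf.stalk z) :
    algebraMap _ X.scheme.functionField r ∈ W := by
  obtain ⟨ψ, -, hψ⟩ := hz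
  exact hψ r ▸ (ψ r).2

lemma Dominates.mem_of_isIntegral {W : ValuationSubring X.scheme.functionField} {z : X.scheme}
    (hz : Dominates W z) {x : X.scheme.functionField}
    (hx : IsIntegral (X.scheme.presheaf.stalk z) x) : x ∈ W := by
  obtain ⟨p, hp, hpx⟩ := hx
  have hW : IsIntegral W x :=
    ⟨p.map ((algebraMap _ X.scheme.functionField).codRestrict W.toSubring hz.algebraMap_mem),
      hp.map _, by rw [Polynomial.eval₂_map]; exact hpx⟩
  obtain ⟨w, rfl⟩ := IsIntegrallyClosed.isIntegral_iff.mp hW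
  exact w.2

lemma Dominates.ne_genericPoint {W : ValuationSubring X.scheme.functionField} {z : X.scheme}
    (hz : Dominates W z) {x : X.scheme.functionField} (hx : x ∉ W) :
    z ≠ genericPoint X.scheme := by
  rintro rfl
  have h : X.scheme.presheaf.stalkSpecializes (genericPoint_specializes _) x ∈ W :=
    hz.algebraMap_mem x
  rw [TopCat.Presheaf.stalkSpecializes_refl] at h
  exact hx h

lemma dominates_of_forall_mem_iff {W : ValuationSubring X.scheme.functionField} {z : X.scheme}
    (h : ∀ x, x ∈ W ↔ IsIntegral (X.scheme.presheaf.stalk z) x) : Dominates W z := by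
  refine ⟨(algebraMap (X.scheme.presheaf.stalk z) X.scheme.functionField).codRestrict W.toSubring
    fun r => (h _).mpr isIntegral_algebraMap, ⟨fun r hr => ?_⟩, fun r => rfl⟩
  obtain ⟨y, hy⟩ := hr.exists_right_inv
  have hry : algebraMap _ X.scheme.functionField r * y = 1 := congrArg Subtype.val hy
  have hyint : IsIntegral (X.scheme.presheaf.stalk z) (y : X.scheme.functionField) := (h _).mp y.2
  have hloc : IsLocalHom (algebraMap (X.scheme.presheaf.stalk z)
    (integralClosure (X.scheme.presheaf.stalk z) X.scheme.functionField)) := inferInstance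
  exact hloc.map_nonunit r (.of_mul_eq_one ⟨_, hyint⟩ (Subtype.ext hry))

end ProjectiveVariety

/-! ### The function field of a rational curve -/

section FunctionField

lemma exists_functionField_ringEquiv_of_isOpenImmersion {U Y : Scheme.{0}} [IsIntegral U]
    [IsIntegral Y] (g : U ⟶ Y) [IsOpenImmersion g] :
    ∃ φ : Y.functionField ≃+* U.functionField, ∀ s : Γ(Y, ⊤),
      φ (Y.presheaf.germ ⊤ _ trivial s) = U.presheaf.germ ⊤ _ trivial (g.appTop s) := by
  have heq : g (genericPoint U) = genericPoint Y := genericPoint_eq_of_isOpenImmersion g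
  let φ : Y.functionField ⟶ U.functionField :=
    (Y.presheaf.stalkCongr (.of_eq heq)).inv ≫ g.stalkMap (genericPoint U)
  have : IsIso φ := inferInstance
  refine ⟨(asIso φ).commRingCatIsoToRingEquiv, fun s => ?_⟩
  have hgerm : (Y.presheaf.stalkCongr (.of_eq heq)).inv (Y.presheaf.germ ⊤ _ trivial s) =
      Y.presheaf.germ ⊤ (g (genericPoint U)) trivial s :=
    Y.presheaf.germ_stalkSpecializes_apply (U := ⊤) trivial (specializes_of_eq heq) s
  exact (congrArg (g.stalkMap (genericPoint U)) hgerm).trans (g.germ_stalkMap_apply ⊤ _ trivial s)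

lemma exists_functionField_ringEquiv_of_birationalOver {S X Y : Scheme.{0}} [IsIntegral X]
    [IsIntegral Y] {sX : X ⟶ S} {sY : Y ⟶ S} (h : Scheme.BirationalOver sX sY) :
    ∃ φ : Y.functionField ≃+* X.functionField, ∀ c : Γ(S, ⊤),
      φ (Y.presheaf.germ ⊤ _ trivial (sY.appTop c)) =
        X.presheaf.germ ⊤ _ trivial (sX.appTop c) := by
  obtain ⟨f, hf⟩ := h
  have : Nonempty f.source := f.dense_source.nonempty.to_subtype
  obtain ⟨φ, hφ⟩ := exists_functionField_ringEquiv_of_isOpenImmersion f.source.ι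
  obtain ⟨χ, hχ⟩ := exists_functionField_ringEquiv_of_isOpenImmersion (f.iso.hom ≫ f.target.ι)
  refine ⟨χ.trans φ.symm, fun c => ?_⟩
  rw [RingEquiv.trans_apply, RingEquiv.symm_apply_eq, hφ, hχ]
  congr 1
  rw [← CommRingCat.comp_apply, ← CommRingCat.comp_apply, ← Scheme.Hom.comp_appTop,
    ← Scheme.Hom.comp_appTop, ← hf, Category.assoc]

lemma eval₂Hom_coord_surjective (n : Type) (R : CommRingCat.{0}) :
    Function.Surjective (MvPolynomial.eval₂Hom
      ((Scheme.ΓSpecIso R).inv ≫ (𝔸(n; Spec R) ↘ Spec R).appTop).hom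
      (AffineSpace.coord (n := n) (Spec R))) := by
  have h := AffineSpace.SpecIso_hom_appTop (n := n) R
  rw [← Iso.inv_comp_eq] at h
  have : IsIso (AffineSpace.SpecIso n R).hom.appTop :=
    inferInstanceAs (IsIso ((AffineSpace.SpecIso n R).hom.app ⊤))
  have hiso : IsIso (CommRingCat.ofHom (MvPolynomial.eval₂Hom
      ((Scheme.ΓSpecIso R).inv ≫ (𝔸(n; Spec R) ↘ Spec R).appTop).hom
      (AffineSpace.coord (n := n) (Spec R)))) := h ▸ IsIso.comp_isIso
  exact ((ConcreteCategory.isIso_iff_bijective _).mp hiso).2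

instance : IsIntegral 𝔸(PUnit; Spec (.of ℂ)) :=
  isIntegral_of_isOpenImmersion (AffineSpace.SpecIso PUnit (.of ℂ)).hom

open IntermediateField

lemma map_mem_adjoin_map_coord {K : Type*} [Field K] [Algebra ℂ K]
    (θ : Γ(𝔸(PUnit; Spec (.of ℂ)), ⊤) →+* K)
    (hθ : ∀ c : ℂ, θ (((Scheme.ΓSpecIso (.of ℂ)).inv ≫
      (𝔸(PUnit; Spec (.of ℂ)) ↘ Spec (.of ℂ)).appTop) c) = algebraMap ℂ K c)
    (s : Γ(𝔸(PUnit; Spec (.of ℂ)), ⊤)) :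
    θ s ∈ ℂ⟮θ (AffineSpace.coord _ PUnit.unit)⟯ := by
  obtain ⟨p, rfl⟩ := eval₂Hom_coord_surjective PUnit (.of ℂ) s
  induction p using MvPolynomial.induction_on with
  | C c =>
    rw [MvPolynomial.coe_eval₂Hom, MvPolynomial.eval₂_C]
    exact (hθ c).symm ▸ IntermediateField.algebraMap_mem _ c
  | add p q hp hq => rw [map_add, map_add]; exact add_mem hp hq
  | mul_X p i hp =>
    rw [map_mul, map_mul, MvPolynomial.coe_eval₂Hom, MvPolynomial.eval₂_X]
    exact mul_mem hp (mem_adjoin_simple_self ℂ _)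

theorem exists_adjoin_simple_eq_top (C : ProjectiveVariety)
    (hrat : Scheme.BirationalOver C.hom (𝔸(PUnit; Spec (.of ℂ)) ↘ Spec (.of ℂ))) :
    ∃ T : C.scheme.functionField, ℂ⟮T⟯ = ⊤ := by
  obtain ⟨φ, hφ⟩ := exists_functionField_ringEquiv_of_birationalOver hrat
  let Y : Scheme.{0} := 𝔸(PUnit; Spec (.of ℂ))
  let θ : Γ(Y, ⊤) →+* C.scheme.functionField :=
    φ.toRingHom.comp (Y.presheaf.germ ⊤ (genericPoint Y) trivial).hom
  have hmem := map_mem_adjoin_map_coord θ fun c => hφ ((Scheme.ΓSpecIso (.of ℂ)).inv c)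
  refine ⟨θ (AffineSpace.coord _ PUnit.unit), eq_top_iff.mpr fun x _ => ?_⟩
  have : Nonempty (⊤ : Y.Opens) := ⟨⟨genericPoint Y, trivial⟩⟩
  have := functionField_isFractionRing_of_isAffineOpen Y ⊤ (isAffineOpen_top Y)
  obtain ⟨a, b, -, hab⟩ := IsFractionRing.div_surjective (A := Γ(Y, ⊤)) (φ.symm x)
  have hx : x = θ a / θ b := by
    rw [RingEquiv.eq_symm_apply, map_div₀] at hab
    exact hab.symm
  exact hx ▸ div_mem (hmem a) (hmem b)

end FunctionField

/-! ### Closed points of a cuspidal curve -/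

section Dimension

variable {C : Scheme.{0}}

lemma krullDim_eq_topologicalKrullDim : Order.krullDim C = topologicalKrullDim C :=
  (Order.krullDim_eq_of_orderIso irreducibleSetEquivPoints).symm

lemma coheight_eq_one_of_ne_genericPoint [IrreducibleSpace C] (hC : topologicalKrullDim C = 1)
    {z : C} (hz : z ≠ genericPoint C) : Order.coheight z = 1 := by
  refine le_antisymm ?_ ?_
  · have := Order.coheight_le_krullDim z
    rw [krullDim_eq_topologicalKrullDim, hC] at this
    exact_mod_cast this
  · rw [Order.one_le_iff_pos, pos_iff_ne_zero, Ne, Order.coheight_eq_zero]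
    intro hmax
    have hle : z ≤ genericPoint C := genericPoint_specializes z
    exact hz (Specializes.antisymm (hmax hle) hle).eq

lemma exists_coheight_eq_one [IrreducibleSpace C] (hC : topologicalKrullDim C = 1) :
    ∃ z : C, Order.coheight z = 1 := by
  have : Nontrivial C := by
    by_contra h
    rw [not_nontrivial_iff_subsingleton] at h
    have hle : Order.krullDim C ≤ 0 := Order.krullDim_nonpos_of_subsingleton
    rw [krullDim_eq_topologicalKrullDim, hC] at hle
    exact absurd hle (by norm_num)
  obtain ⟨z, hz⟩ := exists_ne (genericPoint C)
  exact ⟨z, coheight_eq_one_of_ne_genericPoint hC hz⟩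

lemma not_isField_stalk_of_coheight_eq_one {z : C} (hz : Order.coheight z = 1) :
    ¬ IsField (C.presheaf.stalk z) := by
  intro h
  have hdim := ringKrullDim_stalk_eq_coheight z
  rw [ringKrullDim_eq_zero_of_isField h, hz] at hdim
  exact absurd hdim (by norm_num)

lemma IsSingularPoint.ne_genericPoint [IsIntegral C] {z : C} (hz : IsSingularPoint C z) :
    z ≠ genericPoint C := by
  rintro rfl
  exact hz (inferInstanceAs (IsRegularLocalRing C.functionField))

lemma isLocalRing_integralClosure_of_isDiscreteValuationRing (R K : Type*) [CommRing R]
    [IsDomain R] [IsDiscreteValuationRing R] [Field K] [Algebra R K] [IsFractionRing R K] :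
    IsLocalRing (integralClosure R K) := by
  rw [(IsIntegrallyClosed.integralClosure_eq_bot_iff K).mpr inferInstance]
  exact (Algebra.botEquivOfInjective (IsFractionRing.injective R K)).symm.toRingEquiv.isLocalRing

lemma IsCuspidal.isLocallyIrreducibleAt [IsIntegral C] [IsLocallyNoetherian C]
    (hcusp : IsCuspidal C) {z : C} (hz : Order.coheight z = 1) : IsLocallyIrreducibleAt C z := by
  by_cases hs : IsSingularPoint C z
  · exact hcusp z hs
  have hreg : IsRegularLocalRing (C.presheaf.stalk z) := not_not.mp hs
  have hdim := (IsRegularLocalRing.iff_finrank_cotangentSpace _).mp hreg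
  rw [ringKrullDim_stalk_eq_coheight z, hz] at hdim
  have := IsLocalRing.finrank_CotangentSpace_eq_one_iff.mp (Nat.cast_eq_one.mp hdim)
  exact isLocalRing_integralClosure_of_isDiscreteValuationRing _ _

end Dimension

/-! ### Principal divisors on a rational cuspidal curve -/

section PrincipalDivisor

variable {C : Scheme.{0}} [IsIntegral C] [IsLocallyNoetherian C] {f g : C.functionField}

/-- The divisor of the rational function `f` exists as a finite sum and has degree zero. -/
def HasDegreeZeroDivisor (f : C.functionField) : Prop :=
  ∃ D : C →₀ ℤ, (∀ z, C.ord f z = D z) ∧ D.degree = 0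

lemma ord_eq_zero_of_ordHom_eq_one (hf : f ≠ 0)
    (h : ∀ (z : C) (hz : Order.coheight z = 1), C.ordHom z hz f = 1) (z : C) : C.ord f z = 0 := by
  by_cases hz : Order.coheight z = 1
  · exact (Scheme.ord_eq_iff hz hf).mpr (h z hz)
  · exact Scheme.ord_eq_zero_of_coheight_neq_one hz f

lemma ord_inv (hf : f ≠ 0) (z : C) : C.ord f⁻¹ z = -C.ord f z := by
  have h1 : C.ord (1 : C.functionField) z = 0 :=
    ord_eq_zero_of_ordHom_eq_one one_ne_zero (fun _ _ => map_one _) z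
  rw [← mul_inv_cancel₀ hf, Scheme.ord_mul hf (inv_ne_zero hf)] at h1
  exact (neg_eq_of_add_eq_zero_right h1).symm

namespace HasDegreeZeroDivisor

lemma of_ordHom_eq_one (hf : f ≠ 0)
    (h : ∀ (z : C) (hz : Order.coheight z = 1), C.ordHom z hz f = 1) : HasDegreeZeroDivisor f :=
  ⟨0, ord_eq_zero_of_ordHom_eq_one hf h, map_zero _⟩

lemma mul (hf : f ≠ 0) (hg : g ≠ 0) (hfD : HasDegreeZeroDivisor f) (hgD : HasDegreeZeroDivisor g) :
    HasDegreeZeroDivisor (f * g) := by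
  obtain ⟨D, hD, hD0⟩ := hfD
  obtain ⟨E, hE, hE0⟩ := hgD
  refine ⟨D + E, fun z => ?_, by rw [map_add, hD0, hE0, add_zero]⟩
  rw [Scheme.ord_mul hf hg, hD, hE, Finsupp.add_apply]

lemma inv (hf : f ≠ 0) (hfD : HasDegreeZeroDivisor f) : HasDegreeZeroDivisor f⁻¹ := by
  obtain ⟨D, hD, hD0⟩ := hfD
  refine ⟨-D, fun z => ?_, by rw [map_neg, hD0, neg_zero]⟩
  rw [ord_inv hf, hD, Finsupp.neg_apply]

end HasDegreeZeroDivisor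

end PrincipalDivisor

namespace ProjectiveVariety

open IntermediateField
open scoped OnePoint

variable {C : ProjectiveVariety} {T : C.scheme.functionField} {z z' : C.scheme} {P : OnePoint ℂ}

lemma ordHom_algebraMap_eq_one (hz : Order.coheight z = 1) {c : ℂ} (hc : c ≠ 0) :
    C.scheme.ordHom z hz (algebraMap ℂ _ c) = 1 :=
  have : Ring.KrullDimLE 1 (C.scheme.presheaf.stalk z) := krullDimLE_of_coheight_le hz.le
  ordFrac_algebraMap_eq_one c hc

/-- The point `z` of the curve `C` lies over the point `P` of the projective line with coordinate
`T`: the order of vanishing at `z` is the order at `P`. -/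
def IsPlaceAt (T : C.scheme.functionField) (z : C.scheme) (P : OnePoint ℂ) : Prop :=
  ∃ hz : Order.coheight z = 1, IsPlace (C.scheme.ordHom z hz) T P

lemma IsPlaceAt.unique {Q : OnePoint ℂ} (hP : IsPlaceAt T z P) (hQ : IsPlaceAt T z Q) : P = Q :=
  hP.2.unique hQ.2

lemma IsPlaceAt.ord_sub_algebraMap (h : IsPlaceAt T z P) (b : ℂ) :
    C.scheme.ord (T - algebraMap ℂ _ b) z = linearOrd P b := by
  obtain ⟨hz, hP⟩ := h
  exact (Scheme.ord_eq_iff hz (hP.sub_algebraMap_ne_zero b)).mpr (hP.map_sub_algebraMap b)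

lemma exists_isUniformizer (hcusp : IsCuspidal C.scheme) (hT : ℂ⟮T⟯ = ⊤)
    (hz : Order.coheight z = 1) :
    ∃ π : C.scheme.functionField, IsUniformizer ℂ
        (integralClosure (C.scheme.presheaf.stalk z) C.scheme.functionField).toSubring π ∧
      (Subalgebra.toSubmodule
        (integralClosure (C.scheme.presheaf.stalk z) C.scheme.functionField)).FG ∧
      ∃ P : OnePoint ℂ, IsPlace (C.scheme.ordHom z hz) T P := by
  have : Ring.KrullDimLE 1 (C.scheme.presheaf.stalk z) := krullDimLE_of_coheight_le hz.le
  have : IsLocalRing (integralClosure (C.scheme.presheaf.stalk z) C.scheme.functionField) :=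
    hcusp.isLocallyIrreducibleAt hz
  exact exists_isUniformizer_isPlace (not_isField_stalk_of_coheight_eq_one hz) hT

lemma isIntegral_iff_one_le_ordHom (hcusp : IsCuspidal C.scheme) (hT : ℂ⟮T⟯ = ⊤)
    (hz : Order.coheight z = 1) {x : C.scheme.functionField} (hx : x ≠ 0) :
    IsIntegral (C.scheme.presheaf.stalk z) x ↔ 1 ≤ C.scheme.ordHom z hz x := by
  have : Ring.KrullDimLE 1 (C.scheme.presheaf.stalk z) := krullDimLE_of_coheight_le hz.le
  obtain ⟨π, hπ, hfg, -⟩ := exists_isUniformizer hcusp hT hz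
  exact hπ.mem_iff_one_le_ordFrac hfg hx

lemma IsPlaceAt.eq (hcusp : IsCuspidal C.scheme) (hT : ℂ⟮T⟯ = ⊤) (h : IsPlaceAt T z P)
    (h' : IsPlaceAt T z' P) : z = z' := by
  obtain ⟨hz, hP⟩ := h
  obtain ⟨hz', hP'⟩ := h'
  obtain ⟨π, hπ, -⟩ := exists_isUniformizer hcusp hT hz
  have hW' (x : C.scheme.functionField) :
      x ∈ hπ.valuationSubring ↔ IsIntegral (C.scheme.presheaf.stalk z') x := by
    by_cases hx : x = 0
    · exact hx ▸ iff_of_true (zero_mem _) isIntegral_zero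
    rw [isIntegral_iff_one_le_ordHom hcusp hT hz' hx, ← hP.eq hT hP',
      ← isIntegral_iff_one_le_ordHom hcusp hT hz hx]
    rfl
  -- One valuation ring dominates the local rings at both points, and its center is unique.
  exact (dominates_of_forall_mem_iff fun _ => hπ.mem_valuationSubring).eq
    (dominates_of_forall_mem_iff hW') fun c => algebraMap_mem_of_isScalarTower _ c

lemma exists_one_lt_ordHom (hC : topologicalKrullDim C.scheme = 1) (hcusp : IsCuspidal C.scheme)
    (hT : ℂ⟮T⟯ = ⊤) {U : C.scheme.functionField} (hU : Transcendental ℂ U) :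
    ∃ (z : C.scheme) (hz : Order.coheight z = 1), 1 < C.scheme.ordHom z hz U := by
  obtain ⟨W, hW, hUW⟩ := exists_valuationSubring_mem_nonunits hU
  have hU0 : U ≠ 0 := fun h => hU (h ▸ isAlgebraic_zero)
  have hUinv : U⁻¹ ∉ W := (W.mem_nonunits_iff_or.mp hUW).resolve_left hU0
  obtain ⟨z, hzW⟩ := exists_dominates W hW
  have hz := coheight_eq_one_of_ne_genericPoint hC (hzW.ne_genericPoint hUinv)
  refine ⟨z, hz, lt_of_not_ge fun hle => hUinv (hzW.mem_of_isIntegral ?_)⟩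
  rw [isIntegral_iff_one_le_ordHom hcusp hT hz (inv_ne_zero hU0), map_inv₀]
  exact (one_le_inv₀ (zero_lt_iff.mpr ((map_ne_zero _).mpr hU0))).mpr hle

lemma exists_isPlaceAt (hC : topologicalKrullDim C.scheme = 1) (hcusp : IsCuspidal C.scheme)
    (hT : ℂ⟮T⟯ = ⊤) (hTt : Transcendental ℂ T) (P : OnePoint ℂ) :
    ∃ z : C.scheme, IsPlaceAt T z P := by
  induction P using OnePoint.rec with
  | infty =>
    obtain ⟨z, hz, hlt⟩ := exists_one_lt_ordHom hC hcusp hT (U := T⁻¹)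
      fun h => hTt (IsAlgebraic.inv_iff.mp h)
    obtain ⟨-, -, -, P, hP⟩ := exists_isUniformizer hcusp hT hz
    have h0 := hP.map_sub_algebraMap 0
    rw [map_zero, sub_zero] at h0
    rw [map_inv₀, h0, ← WithZero.exp_neg, ← WithZero.exp_zero, WithZero.exp_lt_exp, neg_pos,
      linearOrd_neg_iff] at hlt
    exact ⟨z, hz, hlt ▸ hP⟩
  | coe b =>
    obtain ⟨z, hz, hlt⟩ := exists_one_lt_ordHom hC hcusp hT (U := T - algebraMap ℂ _ b)
      fun h => hTt (by simpa using h.add (isAlgebraic_algebraMap b))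
    obtain ⟨-, -, -, P, hP⟩ := exists_isUniformizer hcusp hT hz
    rw [hP.map_sub_algebraMap, ← WithZero.exp_zero, WithZero.exp_lt_exp,
      linearOrd_pos_iff] at hlt
    exact ⟨z, hz, hlt ▸ hP⟩

lemma hasDegreeZeroDivisor_sub_algebraMap (hC : topologicalKrullDim C.scheme = 1)
    (hcusp : IsCuspidal C.scheme) (hT : ℂ⟮T⟯ = ⊤) (hTt : Transcendental ℂ T) (b : ℂ) :
    HasDegreeZeroDivisor (T - algebraMap ℂ _ b) := by
  classical
  obtain ⟨zb, hzb⟩ := exists_isPlaceAt hC hcusp hT hTt b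
  obtain ⟨zi, hzi⟩ := exists_isPlaceAt hC hcusp hT hTt ∞
  refine ⟨.single zb 1 - .single zi 1, fun z => ?_, by simp⟩
  by_cases hz : Order.coheight z = 1
  · obtain ⟨-, -, -, P, hP⟩ := exists_isUniformizer hcusp hT hz
    have hP : IsPlaceAt T z P := ⟨hz, hP⟩
    have hPb : P = b ↔ zb = z := ⟨fun h => hzb.eq hcusp hT (h ▸ hP), fun h => (h ▸ hP).unique hzb⟩
    have hPi : P = ∞ ↔ zi = z := ⟨fun h => hzi.eq hcusp hT (h ▸ hP), fun h => (h ▸ hP).unique hzi⟩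
    rw [hP.ord_sub_algebraMap, linearOrd, Finsupp.sub_apply, Finsupp.single_apply,
      Finsupp.single_apply, ← hPb, ← hPi]
    by_cases h : P = b <;> simp [h, apply_ite (Neg.neg : ℤ → ℤ)]
  · have hbz : zb ≠ z := by rintro rfl; exact hz hzb.1
    have hiz : zi ≠ z := by rintro rfl; exact hz hzi.1
    simp [hz, hbz, hiz]

theorem hasDegreeZeroDivisor (hC : topologicalKrullDim C.scheme = 1) (hcusp : IsCuspidal C.scheme)
    (hT : ℂ⟮T⟯ = ⊤) {f : C.scheme.functionField} (hf : f ≠ 0) : HasDegreeZeroDivisor f := by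
  obtain ⟨z₀, hz₀⟩ := exists_coheight_eq_one hC
  obtain ⟨-, -, -, P₀, hP₀⟩ := exists_isUniformizer hcusp hT hz₀
  refine ne_zero_induction_of_adjoin_eq_top hT (fun c hc => ?_)
    (fun b _ => hasDegreeZeroDivisor_sub_algebraMap hC hcusp hT hP₀.transcendental b)
    (fun f g hf hg => .mul hf hg) (fun f hf => .inv hf) f hf
  exact .of_ordHom_eq_one ((map_ne_zero _).mpr hc) fun z hz => ordHom_algebraMap_eq_one hz hc

end ProjectiveVariety

/-! ### Filtrations by order of vanishing -/

section OrderFunction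

lemma semigroupCount_natCast (S : AddSubmonoid ℕ) [DecidablePred (· ∈ S)] (n : ℕ) :
    semigroupCount S n = Nat.count (· ∈ S) n := by
  rw [semigroupCount, Nat.count_eq_card_filter_range, ← Set.ncard_coe_finset]
  congr 2
  ext m
  simp [and_comm]

lemma semigroupCount_nonneg (S : AddSubmonoid ℕ) (t : ℤ) : 0 ≤ semigroupCount S t :=
  Int.natCast_nonneg _

variable {k M : Type*} [Field k] [AddCommGroup M] [Module k M]

variable (k) in
/-- `w` is an order of vanishing on the vector space `M` with at most one-dimensional graded
pieces, whose values lie in the semigroup `S`. The value at `0` is irrelevant. -/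
structure IsOrderFunction (S : AddSubmonoid ℕ) (w : M → ℤ) : Prop where
  exists_mem (x : M) (hx : x ≠ 0) : ∃ m ∈ S, (m : ℤ) = w x
  min_le_add (x y : M) (hx : x ≠ 0) (hy : y ≠ 0) (hxy : x + y ≠ 0) : min (w x) (w y) ≤ w (x + y)
  smul (c : k) (x : M) (hc : c ≠ 0) (hx : x ≠ 0) : w (c • x) = w x
  exists_sub (x y : M) (hx : x ≠ 0) (hy : y ≠ 0) (h : w x = w y) :
    ∃ c : k, x - c • y = 0 ∨ w y < w (x - c • y)

namespace IsOrderFunction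

variable {S : AddSubmonoid ℕ} {w : M → ℤ}

lemma mono {S' : AddSubmonoid ℕ} (hw : IsOrderFunction k S w) (h : S ≤ S') :
    IsOrderFunction k S' w :=
  { hw with exists_mem := fun x hx => (hw.exists_mem x hx).imp fun _ hm => ⟨h hm.1, hm.2⟩ }

lemma comp_injective {N : Type*} [AddCommGroup N] [Module k N] (hw : IsOrderFunction k S w)
    (φ : N →ₗ[k] M) (hφ : ∀ x, x ≠ 0 → φ x ≠ 0) : IsOrderFunction k S (w ∘ φ) where
  exists_mem x hx := hw.exists_mem _ (hφ x hx)
  min_le_add x y hx hy hxy := by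
    have h := hw.min_le_add _ _ (hφ x hx) (hφ y hy) (map_add φ x y ▸ hφ _ hxy)
    rwa [← map_add] at h
  smul c x hc hx := by
    rw [Function.comp_apply, map_smul, hw.smul c _ hc (hφ x hx), Function.comp_apply]
  exists_sub x y hx hy h := by
    obtain ⟨c, hc⟩ := hw.exists_sub _ _ (hφ x hx) (hφ y hy) h
    rw [← map_smul, ← map_sub] at hc
    exact ⟨c, hc.imp_left (not_imp_not.mp (hφ _))⟩

variable (hw : IsOrderFunction k S w)

include hw in
lemma nonneg {x : M} (hx : x ≠ 0) : 0 ≤ w x := by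
  obtain ⟨m, -, hm⟩ := hw.exists_mem x hx
  exact hm ▸ Int.natCast_nonneg m

/-- The subspace of the elements of order at least `n`, a step of the filtration of `M` by `w`. -/
def level (n : ℤ) : Submodule k M where
  carrier := {x | x = 0 ∨ n ≤ w x}
  zero_mem' := Or.inl rfl
  add_mem' := by
    intro x y hx hy
    by_cases hx0 : x = 0
    · rwa [hx0, zero_add]
    by_cases hy0 : y = 0
    · rwa [hy0, add_zero]
    refine or_iff_not_imp_left.mpr fun hxy => ?_
    exact (le_min (hx.resolve_left hx0) (hy.resolve_left hy0)).trans
      (hw.min_le_add x y hx0 hy0 hxy)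
  smul_mem' := by
    intro c x hx
    refine or_iff_not_imp_left.mpr fun hcx => ?_
    obtain ⟨hc, hx0⟩ := smul_ne_zero_iff.mp hcx
    exact (hx.resolve_left hx0).trans_eq (hw.smul c x hc hx0).symm

lemma mem_level_iff {n : ℤ} {x : M} : x ∈ hw.level n ↔ x = 0 ∨ n ≤ w x := .rfl

lemma eq_of_mem_level_of_notMem {n : ℤ} {x : M} (hx : x ∈ hw.level n)
    (hx' : x ∉ hw.level (n + 1)) : w x = n := by
  rw [mem_level_iff, not_or] at hx'
  have := hx.resolve_left hx'.1
  omega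

lemma level_eq_top {n : ℤ} (hn : n ≤ 0) : hw.level n = ⊤ :=
  eq_top_iff.mpr fun _ _ => or_iff_not_imp_left.mpr fun hx => hn.trans (hw.nonneg hx)

lemma level_le_level_succ {n : ℕ} (hn : n ∉ S) : hw.level n ≤ hw.level (n + 1) := by
  intro x hx
  by_contra hx'
  obtain ⟨m, hm, hmx⟩ := hw.exists_mem x fun h0 => hx' (h0 ▸ zero_mem _)
  rw [hw.eq_of_mem_level_of_notMem hx hx', Nat.cast_inj] at hmx
  exact hn (hmx ▸ hm)

lemma inf_level_le_sup_span {N : Submodule k M} {n : ℤ} {y : M} (hyN : y ∈ N)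
    (hy : y ∈ hw.level n) (hy' : y ∉ hw.level (n + 1)) :
    N ⊓ hw.level n ≤ (N ⊓ hw.level (n + 1)) ⊔ Submodule.span k {y} := by
  rintro x ⟨hxN, hx⟩
  by_cases hx' : x ∈ hw.level (n + 1)
  · exact Submodule.mem_sup_left ⟨hxN, hx'⟩
  have hwy : w y = n := hw.eq_of_mem_level_of_notMem hy hy'
  obtain ⟨c, hc⟩ := hw.exists_sub x y (fun h0 => hx' (h0 ▸ zero_mem _))
    (fun h0 => hy' (h0 ▸ zero_mem _)) ((hw.eq_of_mem_level_of_notMem hx hx').trans hwy.symm)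
  have hmem : x - c • y ∈ hw.level (n + 1) := hc.imp_right fun h => by omega
  rw [← sub_add_cancel x (c • y)]
  exact add_mem (Submodule.mem_sup_left ⟨sub_mem hxN (N.smul_mem c hyN), hmem⟩)
    (Submodule.mem_sup_right (Submodule.smul_mem _ c (Submodule.mem_span_singleton_self y)))

lemma finrank_inf_level_le_succ (N : Submodule k M) [Module.Finite k N] (n : ℤ) :
    Module.finrank k (N ⊓ hw.level n : Submodule k M) ≤
      Module.finrank k (N ⊓ hw.level (n + 1) : Submodule k M) + 1 := by
  by_cases h : N ⊓ hw.level n ≤ N ⊓ hw.level (n + 1)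
  · exact (Submodule.finrank_mono h).trans (Nat.le_succ _)
  obtain ⟨y, ⟨hyN, hy⟩, hy'⟩ := SetLike.not_le_iff_exists.mp h
  have hle := hw.inf_level_le_sup_span hyN hy fun h => hy' ⟨hyN, h⟩
  calc Module.finrank k (N ⊓ hw.level n : Submodule k M)
      ≤ Module.finrank k ((N ⊓ hw.level (n + 1)) ⊔ Submodule.span k {y} : Submodule k M) :=
        Submodule.finrank_mono hle
    _ ≤ Module.finrank k (N ⊓ hw.level (n + 1) : Submodule k M) +
        Module.finrank k (Submodule.span k {y}) := Submodule.finrank_add_le_finrank_add_finrank _ _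
    _ ≤ _ := by
        gcongr
        exact finrank_span_le_card _ |>.trans (by simp)

lemma finrank_le_finrank_inf_level_add (N : Submodule k M) [Module.Finite k N] (n : ℤ) :
    (Module.finrank k N : ℤ) ≤
      Module.finrank k (N ⊓ hw.level n : Submodule k M) + semigroupCount S n := by
  classical
  rcases le_or_gt n 0 with hn | hn
  · rw [hw.level_eq_top hn, inf_top_eq]
    exact le_add_of_nonneg_right (semigroupCount_nonneg S n)
  lift n to ℕ using hn.le
  clear hn
  rw [semigroupCount_natCast]
  induction n with
  | zero => rw [Nat.cast_zero, hw.level_eq_top le_rfl, inf_top_eq, Nat.count_zero]; simp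
  | succ n ih =>
    rw [Nat.count_succ, Nat.cast_succ]
    split_ifs with h
    · have := hw.finrank_inf_level_le_succ N n
      omega
    · have := Submodule.finrank_mono (inf_le_inf_left N (hw.level_le_level_succ h))
      omega

end IsOrderFunction

variable {ι : Type*} {S : ι → AddSubmonoid ℕ} {w : ι → M → ℤ} {l : List ι}

lemma exists_le_sum_of_countingFunction_lt (hl : l ≠ [])
    (hw : ∀ i ∈ l, IsOrderFunction k (S i) (w i)) {s : ℤ} (N : Submodule k M) [Module.Finite k N]
    (h : countingFunction (l.map S) s < Module.finrank k N) :
    ∃ x ∈ N, x ≠ 0 ∧ s ≤ (l.map fun i => w i x).sum := by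
  induction l generalizing s N with
  | nil => exact absurd rfl hl
  | cons i l ih =>
    have hwi := hw i List.mem_cons_self
    cases l with
    | nil =>
      change semigroupCount (S i) s < _ at h
      have hrank := hwi.finrank_le_finrank_inf_level_add N s
      obtain ⟨x, ⟨hxN, hxs⟩, hx⟩ : ∃ x ∈ N ⊓ hwi.level s, x ≠ 0 := by
        refine Submodule.exists_mem_ne_zero_of_ne_bot fun hbot => ?_
        rw [hbot, finrank_bot] at hrank
        omega
      exact ⟨x, hxN, hx, by simpa using hxs.resolve_left hx⟩
    | cons j l =>
      obtain ⟨m, hm⟩ : ∃ m, semigroupCount (S i) m +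
          countingFunction ((j :: l).map S) (s - m) < Module.finrank k N :=
        exists_lt_of_ciInf_lt h
      have hrank := hwi.finrank_le_finrank_inf_level_add N m
      obtain ⟨x, ⟨hxN, hxm⟩, hx, hsum⟩ := ih (List.cons_ne_nil j l)
        (fun i' hi' => hw i' (List.mem_cons_of_mem i hi')) (s := s - m) (N ⊓ hwi.level m)
        (by omega)
      have := hxm.resolve_left hx
      refine ⟨x, hxN, hx, ?_⟩
      rw [List.map_cons, List.sum_cons]
      omega

lemma finite_and_finrank_le_of_forall_submodule {B : ℤ}
    (h : ∀ N : Submodule k M, Module.Finite k N → (Module.finrank k N : ℤ) ≤ B) :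
    Module.Finite k M ∧ (Module.finrank k M : ℤ) ≤ B := by
  have hB : 0 ≤ B := by simpa using h ⊥ inferInstance
  lift B to ℕ using hB
  have hrank : Module.rank k M ≤ B := by
    refine rank_le fun s hs => ?_
    have hspan := h (Submodule.span k (s : Set M)) inferInstance
    rw [finrank_span_finset_eq_card hs] at hspan
    exact_mod_cast hspan
  have hfin : Module.Finite k M :=
    Module.rank_lt_aleph0_iff.mp (hrank.trans_lt Cardinal.natCast_lt_aleph0)
  rw [← Module.finrank_eq_rank] at hrank
  exact ⟨hfin, by exact_mod_cast hrank⟩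

theorem finite_and_finrank_le_countingFunction (hl : l ≠ [])
    (hw : ∀ i ∈ l, IsOrderFunction k (S i) (w i)) {t : ℤ}
    (ht : ∀ x : M, x ≠ 0 → (l.map fun i => w i x).sum ≤ t) :
    Module.Finite k M ∧ (Module.finrank k M : ℤ) ≤ countingFunction (l.map S) (t + 1) := by
  refine finite_and_finrank_le_of_forall_submodule fun N _ => ?_
  by_contra! hlt
  obtain ⟨x, -, hx, hsum⟩ := exists_le_sum_of_countingFunction_lt hl hw N hlt
  have := ht x hx
  omega

lemma sum_map_le_degree {R : Type*} [AddCommMonoid R] [PartialOrder R] [IsOrderedAddMonoid R]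
    (E : ι →₀ R) (hE : ∀ i, 0 ≤ E i) (hl : l.Nodup) : (l.map E).sum ≤ E.degree := by
  classical
  rw [← List.sum_toFinset _ hl]
  calc ∑ i ∈ l.toFinset, E i ≤ ∑ i ∈ l.toFinset ∪ E.support, E i :=
        Finset.sum_le_sum_of_subset_of_nonneg Finset.subset_union_left fun i _ _ => hE i
    _ = E.degree :=
        (Finset.sum_subset Finset.subset_union_right fun _ _ => Finsupp.notMem_support_iff.mp).symm

end OrderFunction

/-! ### Coefficients of sections with respect to frames -/

section Frames

variable {X : Scheme.{0}} {L : X.Modules}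

lemma resSection_smul {U V : X.Opens} (h : V ≤ U) (r : Γ(X, U)) (e : Γ(L, U)) :
    resSection L h (r • e) = X.presheaf.map (homOfLE h).op r • resSection L h e :=
  Scheme.Modules.map_smul L (homOfLE h) r e

lemma resSection_resSection {U V W : X.Opens} (h : V ≤ U) (h' : W ≤ V) (e : Γ(L, U)) :
    resSection L h' (resSection L h e) = resSection L (h'.trans h) e :=
  (ConcreteCategory.congr_hom (L.presheaf.map_comp (homOfLE h).op (homOfLE h').op) e).symm

lemma resSection_self {U : X.Opens} (e : Γ(L, U)) : resSection L le_rfl e = e :=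
  ConcreteCategory.congr_hom (L.presheaf.map_id (.op U)) e

lemma resSection_add {U V : X.Opens} (h : V ≤ U) (e f : Γ(L, U)) :
    resSection L h (e + f) = resSection L h e + resSection L h f :=
  map_add _ _ _

variable {U V : X.Opens} {e : Γ(L, U)} {f : Γ(L, V)}

lemma IsFrame.res (he : IsFrame L U e) (h : V ≤ U) : IsFrame L V (resSection L h e) := by
  intro W hW
  simpa only [resSection_resSection] using he W (hW.trans h)

lemma IsFrame.smul_injective {a b : Γ(X, U)} (he : IsFrame L U e) (h : a • e = b • e) : a = b :=
  (he U le_rfl).1 (by simpa only [resSection_self] using h)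

/-- The coefficient of a global section with respect to a frame. -/
def frameCoeff (he : IsFrame L U e) (u : Γ(L, ⊤)) : Γ(X, U) :=
  ((he U le_rfl).2 (resSection L le_top u)).choose

variable (he : IsFrame L U e)

lemma frameCoeff_smul_eq (u : Γ(L, ⊤)) : frameCoeff he u • e = resSection L le_top u := by
  have h : frameCoeff he u • resSection L le_rfl e = resSection L le_top u :=
    ((he U le_rfl).2 (resSection L le_top u)).choose_spec
  rwa [resSection_self] at h

lemma frameCoeff_eq {u : Γ(L, ⊤)} {a : Γ(X, U)} (h : resSection L le_top u = a • e) :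
    frameCoeff he u = a :=
  he.smul_injective ((frameCoeff_smul_eq he u).trans h)

lemma frameCoeff_add (u v : Γ(L, ⊤)) : frameCoeff he (u + v) = frameCoeff he u + frameCoeff he v :=
  frameCoeff_eq he (by rw [resSection_add, add_smul, frameCoeff_smul_eq, frameCoeff_smul_eq])

lemma frameCoeff_smul (r : Γ(X, ⊤)) (u : Γ(L, ⊤)) :
    frameCoeff he (r • u) = X.presheaf.map (homOfLE le_top).op r * frameCoeff he u :=
  frameCoeff_eq he (by rw [resSection_smul, mul_smul, frameCoeff_smul_eq])

lemma map_frameCoeff_eq (hf : IsFrame L V f) {a : Γ(X, U ⊓ V)}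
    (ha : resSection L (inf_le_left : U ⊓ V ≤ U) e =
      a • resSection L (inf_le_right : U ⊓ V ≤ V) f) (u : Γ(L, ⊤)) :
    X.presheaf.map (homOfLE (inf_le_right : U ⊓ V ≤ V)).op (frameCoeff hf u) =
      a * X.presheaf.map (homOfLE (inf_le_left : U ⊓ V ≤ U)).op (frameCoeff he u) := by
  refine (hf.res inf_le_right).smul_injective ?_
  rw [← resSection_smul, frameCoeff_smul_eq, resSection_resSection, mul_comm, mul_smul, ← ha,
    ← resSection_smul, frameCoeff_smul_eq, resSection_resSection]

variable {C : Scheme.{0}} (i : C ⟶ X) {z : C}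

lemma germ_app_map (h : V ≤ U) (hz : z ∈ i ⁻¹ᵁ V) (r : Γ(X, U)) :
    C.presheaf.germ (i ⁻¹ᵁ V) z hz (i.app V (X.presheaf.map (homOfLE h).op r)) =
      C.presheaf.germ (i ⁻¹ᵁ U) z (show z ∈ i ⁻¹ᵁ U from h hz) (i.app U r) := by
  have hnat : i.app V (X.presheaf.map (homOfLE h).op r) =
      C.presheaf.map ((Opens.map i.base).map (homOfLE h)).op (i.app U r) :=
    ConcreteCategory.congr_hom (i.naturality (homOfLE h).op) r
  rw [hnat]
  exact C.presheaf.germ_res_apply _ _ _ _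

/-- The coefficient of the pullback of a global section along `i : C ⟶ X` with respect to a frame,
as a germ at `z`. -/
def stalkCoeff (hz : z ∈ i ⁻¹ᵁ U) (u : Γ(L, ⊤)) : C.presheaf.stalk z :=
  C.presheaf.germ (i ⁻¹ᵁ U) z hz (i.app U (frameCoeff he u))

lemma stalkCoeff_add (hz : z ∈ i ⁻¹ᵁ U) (u v : Γ(L, ⊤)) :
    stalkCoeff he i hz (u + v) = stalkCoeff he i hz u + stalkCoeff he i hz v := by
  rw [stalkCoeff, frameCoeff_add, map_add, map_add]
  rfl

lemma stalkCoeff_smul (hz : z ∈ i ⁻¹ᵁ U) (r : Γ(X, ⊤)) (u : Γ(L, ⊤)) :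
    stalkCoeff he i hz (r • u) =
      C.presheaf.germ ⊤ z trivial (i.appTop r) * stalkCoeff he i hz u := by
  rw [stalkCoeff, frameCoeff_smul, map_mul, map_mul, germ_app_map i le_top hz]
  rfl

lemma stalkCoeff_change (hf : IsFrame L V f) {a : Γ(X, U ⊓ V)}
    (ha : resSection L (inf_le_left : U ⊓ V ≤ U) e =
      a • resSection L (inf_le_right : U ⊓ V ≤ V) f)
    (hU : z ∈ i ⁻¹ᵁ U) (hV : z ∈ i ⁻¹ᵁ V) (u : Γ(L, ⊤)) :
    stalkCoeff hf i hV u = C.presheaf.germ (i ⁻¹ᵁ (U ⊓ V)) z ⟨hU, hV⟩ (i.app (U ⊓ V) a) *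
      stalkCoeff he i hU u := by
  have h := congrArg (fun r => C.presheaf.germ (i ⁻¹ᵁ (U ⊓ V)) z ⟨hU, hV⟩ (i.app (U ⊓ V) r))
    (map_frameCoeff_eq he hf ha u)
  simp only [map_mul] at h
  rwa [germ_app_map i inf_le_right ⟨hU, hV⟩, germ_app_map i inf_le_left ⟨hU, hV⟩] at h

lemma exists_frame_change (hf : IsFrame L V f) :
    ∃ a : Γ(X, U ⊓ V), resSection L (inf_le_left : U ⊓ V ≤ U) e =
      a • resSection L (inf_le_right : U ⊓ V ≤ V) f :=
  ((hf (U ⊓ V) inf_le_right).2 _).imp fun _ => Eq.symm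

lemma isUnit_stalkCoeff {u : Γ(L, ⊤)} (hu : ¬ VanishesAt L u (i z)) :
    ∃ (V : X.Opens) (hz : z ∈ i ⁻¹ᵁ V) (f : Γ(L, V)) (hf : IsFrame L V f),
      IsUnit (stalkCoeff hf i hz u) := by
  unfold VanishesAt at hu
  push Not at hu
  obtain ⟨V, hz, f, hf, a, ha, hza⟩ := hu
  refine ⟨V, hz, f, hf, ?_⟩
  have hzb : z ∈ i ⁻¹ᵁ X.basicOpen a := hza
  rw [Scheme.preimage_basicOpen] at hzb
  rw [← frameCoeff_eq hf ha] at hzb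
  exact (C.mem_basicOpen (i.app V (frameCoeff hf u)) z hz).mp hzb

variable [IsIntegral C]

lemma algebraMap_stalkCoeff (hz : z ∈ i ⁻¹ᵁ U) (u : Γ(L, ⊤)) :
    algebraMap (C.presheaf.stalk z) C.functionField (stalkCoeff he i hz u) =
      stalkCoeff he i (genericPoint_mem_preimage i hz) u :=
  C.presheaf.germ_stalkSpecializes_apply hz ((genericPoint_spec C).specializes trivial) _

lemma stalkCoeff_mul_coeff (s : RationalSection i L) (hf : IsFrame L V f)
    (hU : genericPoint C ∈ i ⁻¹ᵁ U) (hV : genericPoint C ∈ i ⁻¹ᵁ V) (u : Γ(L, ⊤)) :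
    stalkCoeff hf i hV u * s.coeff U e he hU = stalkCoeff he i hU u * s.coeff V f hf hV := by
  obtain ⟨a, ha⟩ := exists_frame_change (U := U) (e := e) hf
  rw [stalkCoeff_change he i hf ha hU hV, s.coeff_change U V e f he hf hU hV a ha]
  ring

lemma stalkCoeff_ne_zero {u : Γ(L, ⊤)} {x : C} (hx : ¬ VanishesAt L u (i x))
    (hz : z ∈ i ⁻¹ᵁ U) : stalkCoeff he i hz u ≠ 0 := by
  intro h0
  obtain ⟨V, hxV, f, hf, hunit⟩ := isUnit_stalkCoeff i hx
  obtain ⟨a, ha⟩ := exists_frame_change (U := U) (e := e) hf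
  have hgen := hunit.map (algebraMap _ C.functionField)
  rw [algebraMap_stalkCoeff, stalkCoeff_change he i hf ha (genericPoint_mem_preimage i hz),
    ← algebraMap_stalkCoeff he i hz, h0, map_zero, mul_zero] at hgen
  exact not_isUnit_zero hgen

end Frames

/-! ### Orders of vanishing of sections along a curve -/

section SectionOrd

variable {X C : Scheme.{0}} [IsIntegral C] [IsLocallyNoetherian C] {L : X.Modules}

/-- The order of vanishing at `z` of the pullback of the global section `u` of the line bundle `L`,
computed with a chosen frame of `L` around `i z`. -/
def sectionOrd (hL : IsLineBundle L) (i : C ⟶ X) (z : C) (u : Γ(L, ⊤)) : ℤ :=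
  C.ord (algebraMap _ C.functionField (stalkCoeff (hL (i z)).choose_spec.choose_spec.choose_spec
    i (z := z) (hL (i z)).choose_spec.choose u)) z

lemma exists_sectionOrd_eq_ord (hL : IsLineBundle L) (i : C ⟶ X) (z : C) :
    ∃ (U : X.Opens) (hz : z ∈ i ⁻¹ᵁ U) (e : Γ(L, U)) (he : IsFrame L U e), ∀ u : Γ(L, ⊤),
      sectionOrd hL i z u = C.ord (algebraMap _ C.functionField (stalkCoeff he i hz u)) z :=
  ⟨_, _, _, _, fun _ => rfl⟩

lemma exists_mem_pointSemigroup_eq_ord {z : C} (hz : Order.coheight z = 1) {r : C.presheaf.stalk z}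
    (hr : r ≠ 0) : ∃ m ∈ pointSemigroup z, (m : ℤ) = C.ord (algebraMap _ C.functionField r) z := by
  have : Ring.KrullDimLE 1 (C.presheaf.stalk z) := krullDimLE_of_coheight_le hz.le
  have hr' := mem_nonZeroDivisors_of_ne_zero hr
  obtain ⟨m, hm⟩ := ENat.ne_top_iff_exists.mp (Ring.ord_ne_top hr')
  refine ⟨m, ⟨r, hr, hm.symm⟩, ?_⟩
  rw [eq_comm, Scheme.ord_eq_iff hz (by simpa using hr)]
  change Ring.ordFrac _ _ = _
  rw [Ring.ordFrac_eq_ord _ hr, Ring.ordMonoidWithZeroHom_eq_coe _ hr' hm.symm]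

variable (hL : IsLineBundle L) {i : C ⟶ X} {u : Γ(L, ⊤)}

lemma sectionOrd_nonneg {x : C} (hx : ¬ VanishesAt L u (i x)) (z : C) :
    0 ≤ sectionOrd hL i z u := by
  obtain ⟨U, hzU, e, he, hord⟩ := exists_sectionOrd_eq_ord hL i z
  rw [hord]
  by_cases hz : Order.coheight z = 1
  · obtain ⟨m, -, hm⟩ := exists_mem_pointSemigroup_eq_ord hz (stalkCoeff_ne_zero he i hx hzU)
    exact hm ▸ Int.natCast_nonneg m
  · exact (Scheme.ord_eq_zero_of_coheight_neq_one hz _).ge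

lemma exists_sectionOrd_eq_ord_add {s : RationalSection i L} {D : C →₀ ℤ} (hD : IsDivisorOf s D)
    {x : C} (hx : ¬ VanishesAt L u (i x)) :
    ∃ f : C.functionField, f ≠ 0 ∧ ∀ z, sectionOrd hL i z u = C.ord f z + D z := by
  obtain ⟨U, hU, e, he⟩ := hL (i (genericPoint C))
  have hf : stalkCoeff he i hU u / s.coeff U e he hU ≠ 0 :=
    div_ne_zero (stalkCoeff_ne_zero he i hx hU) (s.coeff_ne_zero U e he hU)
  refine ⟨_, hf, fun z => ?_⟩
  obtain ⟨V, hzV, f, hf', hord⟩ := exists_sectionOrd_eq_ord hL i z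
  have hV := genericPoint_mem_preimage i hzV
  rw [hord, algebraMap_stalkCoeff, hD z V hzV f hf',
    ← Scheme.ord_mul hf (s.coeff_ne_zero V f hf' hV), div_mul_eq_mul_div,
    ← stalkCoeff_mul_coeff he i s hf' hU hV, mul_div_cancel_right₀ _ (s.coeff_ne_zero U e he hU)]

lemma sum_sectionOrd_le (hC : ∀ f : C.functionField, f ≠ 0 → HasDegreeZeroDivisor f) {t : ℤ}
    (ht : IsDegree i L t) {x : C} (hx : ¬ VanishesAt L u (i x)) {l : List C} (hl : l.Nodup) :
    (l.map fun z => sectionOrd hL i z u).sum ≤ t := by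
  obtain ⟨s, D, hD, rfl⟩ := ht
  obtain ⟨f, hf, hfD⟩ := exists_sectionOrd_eq_ord_add hL hD hx
  obtain ⟨E, hE, hE0⟩ := hC f hf
  have hord (z : C) : sectionOrd hL i z u = (E + D) z := by
    rw [hfD, hE, Finsupp.add_apply]
  calc (l.map fun z => sectionOrd hL i z u).sum = (l.map (E + D)).sum := by simp only [hord]
    _ ≤ (E + D).degree := sum_map_le_degree _ (fun z => hord z ▸ sectionOrd_nonneg hL hx z) hl
    _ = D.degree := by rw [map_add, hE0, zero_add]

end SectionOrd

namespace ProjectiveVariety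

open IntermediateField

variable {X C : ProjectiveVariety} {T : C.scheme.functionField} {z : C.scheme}

theorem isOrderFunction_ord_algebraMap (hcusp : IsCuspidal C.scheme) (hT : ℂ⟮T⟯ = ⊤)
    (hz : Order.coheight z = 1) :
    IsOrderFunction ℂ (pointSemigroup z) fun r : C.scheme.presheaf.stalk z =>
      C.scheme.ord (algebraMap _ C.scheme.functionField r) z := by
  have : Ring.KrullDimLE 1 (C.scheme.presheaf.stalk z) := krullDimLE_of_coheight_le hz.le
  obtain ⟨π, hπ, hfg, -⟩ := exists_isUniformizer hcusp hT hz
  let ρ := algebraMap (C.scheme.presheaf.stalk z) C.scheme.functionField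
  have hne {r : C.scheme.presheaf.stalk z} (hr : r ≠ 0) : ρ r ≠ 0 := by simpa [ρ] using hr
  have hsmul (c : ℂ) (r : C.scheme.presheaf.stalk z) : ρ (c • r) = algebraMap ℂ _ c * ρ r := by
    rw [Algebra.smul_def, map_mul, ← IsScalarTower.algebraMap_apply]
  refine ⟨fun r hr => exists_mem_pointSemigroup_eq_ord hz hr, fun r r' hr hr' hrr' => ?_,
    fun c r hc hr => ?_, fun r r' hr hr' h => ?_⟩
  · have hmin := hπ.min_ordFrac_le_add hfg (x := ρ r) (y := ρ r') (map_add ρ r r' ▸ hne hrr')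
    rw [← map_add, min_le_iff] at hmin
    rwa [min_le_iff, Scheme.ord_le_ord_iff hz hz (hne hr) (hne hrr'),
      Scheme.ord_le_ord_iff hz hz (hne hr') (hne hrr')]
  · have hc' : algebraMap ℂ C.scheme.functionField c ≠ 0 := (map_ne_zero _).mpr hc
    change C.scheme.ord (ρ (c • r)) z = _
    rw [hsmul, Scheme.ord_mul hc' (hne hr),
      (Scheme.ord_eq_iff hz hc' (n := 0)).mpr (ordHom_algebraMap_eq_one hz hc), zero_add]
  · have hordHom : C.scheme.ordHom z hz (ρ r) = C.scheme.ordHom z hz (ρ r') :=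
      le_antisymm ((Scheme.ord_le_ord_iff hz hz (hne hr) (hne hr')).mp h.le)
        ((Scheme.ord_le_ord_iff hz hz (hne hr') (hne hr)).mp h.ge)
    obtain ⟨c, hc⟩ := hπ.exists_sub_eq_zero_or_lt hfg (hne hr') hordHom
    rw [← hsmul, ← map_sub] at hc
    refine ⟨c, or_iff_not_imp_left.mpr fun h0 => ?_⟩
    rw [← not_le, Scheme.ord_le_ord_iff hz hz (hne h0) (hne hr'), not_le]
    exact hc.resolve_left (hne h0)

variable {i : C.scheme ⟶ X.scheme} {L : X.scheme.Modules}

/-- `stalkCoeff` as a `ℂ`-linear map on the global sections. -/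
def stalkCoeffLinearMap (hiX : i ≫ X.hom = C.hom) {U : X.scheme.Opens} {e : Γ(L, U)}
    (he : IsFrame L U e) (hz : z ∈ i ⁻¹ᵁ U) :
    GlobalSections X L →ₗ[ℂ] C.scheme.presheaf.stalk z where
  toFun := stalkCoeff he i hz
  map_add' := stalkCoeff_add he i hz
  map_smul' c u := by
    have hc : i.appTop (X.constants c) = C.constants c := by
      change ((Scheme.ΓSpecIso (.of ℂ)).inv ≫ X.hom.appTop ≫ i.appTop) c =
        ((Scheme.ΓSpecIso (.of ℂ)).inv ≫ C.hom.appTop) c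
      rw [← Scheme.Hom.comp_appTop, hiX]
    rw [RingHom.id_apply, Algebra.smul_def, algebraMap_stalk_apply, ← hc]
    exact stalkCoeff_smul he i hz (X.constants c) u

lemma isOrderFunction_sectionOrd (hcusp : IsCuspidal C.scheme) (hT : ℂ⟮T⟯ = ⊤)
    (hiX : i ≫ X.hom = C.hom) (hL : IsLineBundle L)
    (hvan : ∀ u : GlobalSections X L, (∀ x : C.scheme, VanishesAt L u (i x)) → u = 0)
    (hz : Order.coheight z = 1) :
    IsOrderFunction ℂ (M := GlobalSections X L) (pointSemigroup z) (sectionOrd hL i z) := by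
  obtain ⟨U, hzU, e, he, hord⟩ := exists_sectionOrd_eq_ord hL i z
  rw [funext hord]
  refine (isOrderFunction_ord_algebraMap hcusp hT hz).comp_injective
    (stalkCoeffLinearMap hiX he hzU) fun u hu => ?_
  obtain ⟨x, hx⟩ := not_forall.mp (mt (hvan u) hu)
  exact stalkCoeff_ne_zero he i hx hzU

end ProjectiveVariety

end

theorem theorem3_general
    (X C : ProjectiveVariety) (hC : topologicalKrullDim C.scheme = 1)
    (i : C.scheme ⟶ X.scheme) (hiX : i ≫ X.hom = C.hom)
    (hrat : Scheme.BirationalOver C.hom (𝔸(PUnit; Spec (.of ℂ)) ↘ Spec (.of ℂ)))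
    (hcusp : IsCuspidal C.scheme)
    (z : List C.scheme) (hz_nodup : z.Nodup) (hz : ∀ x ∈ z, x ≠ genericPoint C.scheme)
    (L : X.scheme.Modules) (hL : IsLineBundle L) (t : ℤ) (ht : IsDegree i L t)
    (hvan : ∀ u : GlobalSections X L, (∀ x : C.scheme, VanishesAt L u (i x)) → u = 0) :
    Module.Finite ℂ (GlobalSections X L) ∧
      (Module.finrank ℂ (GlobalSections X L) : ℤ) ≤
        countingFunction (z.map pointSemigroup) (t + 1) := by
  obtain ⟨T, hT⟩ := exists_adjoin_simple_eq_top C hrat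
  have hsum {l : List C.scheme} (hl : l.Nodup) (u : GlobalSections X L) (hu : u ≠ 0) :
      (l.map fun x => sectionOrd hL i x u).sum ≤ t := by
    obtain ⟨x, hx⟩ := not_forall.mp (mt (hvan u) hu)
    exact sum_sectionOrd_le hL (fun f hf => ProjectiveVariety.hasDegreeZeroDivisor hC hcusp hT hf)
      ht hx hl
  have hord {x : C.scheme} (hx : Order.coheight x = 1) :=
    ProjectiveVariety.isOrderFunction_sectionOrd hcusp hT hiX hL hvan hx
  obtain rfl | hnil := eq_or_ne z []
  · obtain ⟨z₀, hz₀⟩ := exists_coheight_eq_one hC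
    exact finite_and_finrank_le_countingFunction (List.cons_ne_nil z₀ []) (S := fun _ => ⊤)
      (fun x hx => (hord (List.mem_singleton.mp hx ▸ hz₀)).mono le_top)
      (hsum (List.nodup_singleton z₀))
  · exact finite_and_finrank_le_countingFunction hnil
      (fun x hx => hord (coheight_eq_one_of_ne_genericPoint hC (hz x hx))) (hsum hz_nodup)

theorem theorem3
    (X C : ProjectiveVariety) (hX : topologicalKrullDim X.scheme = 2)
    (hC : topologicalKrullDim C.scheme = 1)
    (i : C.scheme ⟶ X.scheme) (hi : IsClosedImmersion i) (hiX : i ≫ X.hom = C.hom)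
    (hrat : Scheme.BirationalOver C.hom (𝔸(PUnit; Spec (.of ℂ)) ↘ Spec (.of ℂ)))
    (hcusp : IsCuspidal C.scheme)
    (z : List C.scheme) (hz_nodup : z.Nodup)
    (hz : ∀ x : C.scheme, x ∈ z ↔ IsSingularPoint C.scheme x)
    (L : X.scheme.Modules) (hL : IsLineBundle L)
    (t : ℤ) (ht : IsDegree i L t) (ht_pos : 0 < t)
    (hsec : Nontrivial (GlobalSections X L))
    (hvan : ∀ u : GlobalSections X L, (∀ x : C.scheme, VanishesAt L u (i x)) → u = 0) :
    Module.Finite ℂ (GlobalSections X L) ∧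
      (Module.finrank ℂ (GlobalSections X L) : ℤ) ≤
        countingFunction (z.map pointSemigroup) (t + 1) :=
  theorem3_general X C hC i hiX hrat hcusp z hz_nodup
    (fun x hx => ((hz x).mp hx).ne_genericPoint) L hL t ht hvan
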